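/- Let $n\ge 2$ and let $K\subset\mathbb R^n$ be a convex body with $0\in\operatorname{int}K$, with boundary of class $C^2$ and with everywhere positive Gauss curvature. For $x\in\partial K$ let $\nu(x)$ be the outer unit normal and $\kappa(x)$ the Gauss curvature at $x$; for a unit vector $u$ let $X_K(u)\in\partial K$ be the point with outer unit normal $u$. Let $\kappa_0(x)=\kappa(x)/(x\cdot\nu(x))^{n+1}$ be the centro-affine curvature, and write $\kappa_0(u)=\kappa_0(X_K(u))$. Let $\mu_{cK}$ be the cone measure on $\partial K$, $\mu_{cK}(A)=n\,\mathrm{Vol}\{sx: x\in A,\ 0\le s\le 1\}$, that is, $d\mu_{cK}(x)=(x\cdot\nu(x))\,dS(x)$. Let $L^\circ=\{y: x\cdot y\le 1\ \forall x\in L\}$ denote the polar of $L$. Let $\phi:(0,\infty)\to(0,\infty)$ be any function such that $\phi\circ\kappa_0$ is $\mu_{cK}$-measurable (for instance any Borel function), and put $\Phi(K)=\int_{\partial K}\phi(\kappa_0)\,d\mu_{cK}\in[0,\infty]$. Then there is a family of convex bodies $K_\phi(t)$, $t>0$, with $0\in\operatorname{int}K_\phi(t)$, such that $$\Phi(K)=\lim_{t\searrow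 0}\frac{\mathrm{Vol}(K_\phi(t)^\circ)-\mathrm{Vol}(K^\circ)}{t}.$$ Moreover, if $u\mapsto\phi(\kappa_0(u))$ is continuous on $\mathbb S^{n-1}$ (for instance if $\phi$ is continuous), then $\Phi(K)<\infty$, and the family can be chosen so that for all sufficiently small $t>0$ the body $K_\phi(t)$ is the floating body of $K$ with the direction-dependent cap volumes $$\delta_t(u)=\frac{\omega_{n-1}}{n+1}\left[\,2t\,\phi(\kappa_0(u))\,\kappa_0(u)^{-\frac{n+2}{n+1}}\right]^{\frac{n+1}{2}},\qquad \omega_{n-1}=\mathrm{Vol}(B^{n-1}),$$ where $B^{n-1}$ is the unit ball of $\mathbb R^{n-1}$. That is, for such $t$ one has $\delta_t(u)<\mathrm{Vol}(K)/2$ for all $u\in\mathbb S^{n-1}$, and $$K_\phi(t)=\bigcap_{u\in\mathbb S^{n-1}}\{y: u\cdot y\le s_t(u)\},\qquad\text{where } s_t(u) \text{ is determined by }\ \mathrm{Vol}\{y\in K: u\cdot y\ge s_t(u)\}=\delta_t(u).$$ -/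

import Mathlib

open MeasureTheory Filter Topology
open scoped RealInnerProductSpace ENNReal

namespace PolarFloating

noncomputable section

/-- Euclidean space `ℝⁿ`. -/
abbrev Space (n : ℕ) : Type := EuclideanSpace ℝ (Fin n)

/-- The polar set `K° = {y | ⟪x, y⟫ ≤ 1 for all x ∈ K}` with respect to the origin. -/
def polarBody {n : ℕ} (K : Set (Space n)) : Set (Space n) :=
  {y | ∀ x ∈ K, ⟪x, y⟫ ≤ 1}

/-- The (closed) set `K` has boundary of class `C²`: near each boundary point it is a sublevel set
`{F ≤ 0}` of a function of class `C²` whose differential does not vanish there. -/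
def HasC2Boundary {n : ℕ} (K : Set (Space n)) : Prop :=
  ∀ p ∈ frontier K, ∃ F : Space n → ℝ,
    ContDiffAt ℝ 2 F p ∧ fderiv ℝ F p ≠ 0 ∧ ∀ᶠ x in 𝓝 p, (x ∈ K ↔ F x ≤ 0)

/-- `u` is an outer unit normal vector of the convex set `K` at its point `x`. -/
def IsOuterUnitNormal {n : ℕ} (K : Set (Space n)) (x u : Space n) : Prop :=
  ‖u‖ = 1 ∧ ∀ y ∈ K, ⟪y, u⟫ ≤ ⟪x, u⟫

/-- The Gauss map `ν` of `K`: the outer unit normal at a boundary point `x`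
(it exists for convex `K`, and is unique when the boundary is `C²`). -/
def gaussMap {n : ℕ} (K : Set (Space n)) (x : Space n) : Space n :=
  Classical.epsilon (IsOuterUnitNormal K x)

/-- The Gauss curvature of `∂K` at `x ∈ ∂K`: the determinant of the differential
`dν_x : T_x ∂K → T_x ∂K` of the Gauss map, with `T_x ∂K = ν(x)ᗮ`. The derivative is taken along
the boundary; on tangent vectors it is uniquely determined and tangent-valued, so that the
orthogonal projection only adjusts the codomain. -/
def gaussCurvature {n : ℕ} (K : Set (Space n)) (x : Space n) : ℝ :=
  let T : Submodule ℝ (Space n) := (ℝ ∙ gaussMap K x)ᗮ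
  LinearMap.det ((T.orthogonalProjectionOnto : Space n →ₗ[ℝ] T) ∘ₗ
    (fderivWithin ℝ (gaussMap K) (frontier K) x : Space n →ₗ[ℝ] Space n) ∘ₗ T.subtype)

/-- Class `C²₊`: boundary of class `C²` with everywhere positive Gauss curvature. -/
def IsC2Plus {n : ℕ} (K : Set (Space n)) : Prop :=
  HasC2Boundary K ∧ ∀ x ∈ frontier K, 0 < gaussCurvature K x

/-- The centro-affine curvature `κ₀(x) = κ(x) / ⟪x, ν(x)⟫ ^ (n + 1)` at `x ∈ ∂K`. -/
def centroAffineCurvature {n : ℕ} (K : Set (Space n)) (x : Space n) : ℝ :=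
  gaussCurvature K x / ⟪x, gaussMap K x⟫ ^ (n + 1)

/-- The point `X_K(u)` of `∂K` at which the outer unit normal is `u` (unique for `K` of class
`C²₊`). -/
def boundaryPoint {n : ℕ} (K : Set (Space n)) (u : Space n) : Space n :=
  Classical.epsilon fun x => x ∈ K ∧ IsOuterUnitNormal K x u

/-- The cone measure of `K`, with the normalization `dμ = ⟪x, ν(x)⟫ dS(x)` on `∂K`, that is,
`μ(A) = n · Vol {s • x | x ∈ A, 0 ≤ s ≤ 1}` for Borel `A ⊆ ∂K`: it is `n` times the image of
Lebesgue measure on `K` under the radial projection to `∂K`. -/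
def coneMeasure {n : ℕ} (K : Set (Space n)) : Measure (Space n) :=
  (n : ℝ≥0∞) • ((volume.restrict K).map fun x => (gauge K x)⁻¹ • x)

/-- The functional `Φ(K) = ∫_{∂K} φ(κ₀) dμ_{cK}`, with values in `[0, ∞]`. -/
def affineSurfaceArea {n : ℕ} (φ : ℝ → ℝ) (K : Set (Space n)) : ℝ≥0∞ :=
  ∫⁻ x, ENNReal.ofReal (φ (centroAffineCurvature K x)) ∂(coneMeasure K)

/-- The volume of the cap of `K` cut off by the hyperplane `{y | ⟪u, y⟫ = s}`, on the side to which
`u` points. -/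
def capVolume {n : ℕ} (K : Set (Space n)) (u : Space n) (s : ℝ) : ℝ :=
  volume.real {y | y ∈ K ∧ s ≤ ⟪u, y⟫}

/-- The floating body of `K` with direction-dependent cap volumes `δ(u)`: the intersection, over all
unit vectors `u`, of the half-spaces `{y | ⟪u, y⟫ ≤ s}` whose bounding hyperplane cuts off from `K`
a cap of volume `δ(u)`. (If `0 < δ(u) < Vol K`, there is exactly one such `s`.) -/
def floatingBody {n : ℕ} (K : Set (Space n)) (δ : Space n → ℝ) : Set (Space n) :=
  {y | ∀ u : Space n, ‖u‖ = 1 → ∀ s : ℝ, capVolume K u s = δ u → ⟪u, y⟫ ≤ s}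

/-- The cap volume in direction `u` at parameter `t`,
`ω_{n-1} / (n+1) · (2 t φ(κ₀(u)) κ₀(u)^{-(n+2)/(n+1)})^{(n+1)/2}`,
where `ω_{n-1}` is the volume of the unit ball of `ℝⁿ⁻¹` and `κ₀(u)` is the centro-affine curvature
at the boundary point with outer unit normal `u`. -/
def capFunction {n : ℕ} (φ : ℝ → ℝ) (K : Set (Space n)) (t : ℝ) (u : Space n) : ℝ :=
  let κ₀ : ℝ := centroAffineCurvature K (boundaryPoint K u)
  volume.real (Metric.ball (0 : Space (n - 1)) 1) / ((n : ℝ) + 1) *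
    (2 * t * φ κ₀ * κ₀ ^ (-(((n : ℝ) + 2) / ((n : ℝ) + 1)))) ^ (((n : ℝ) + 1) / 2)

end

end PolarFloating

/-! Let g be the gauge of K and G = ∇(g²/2) the duality map (`dualityMap`). G is homogeneous of
degree 1, maps K onto K° up to the origin, and its Jacobian J is constant along rays. On ∂K, J
equals κ₀ (`centroAffineCurvature_eq`). Hence Vol(K°) = ∫_K J, and Φ(K) = n ∫_K φ(J)
(`affineSurfaceArea_eq`).

Near x ∈ ∂K the body is squeezed between dilates of the ellipsoid with quadratic form G'(x). A
linear map of determinant √J(x) turns this ellipsoid into the unit ball. So the cap {y ∈ K : ⟨G(x),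
y⟩ ≥ 1 - τ} has volume asymptotic to ω_{n-1}/(n+1) · (2τ)^((n+1)/2) · J(x)^(-1/2), uniformly in x
(`exists_capTerm_bounds`). With τ = t φ(J)/J this is exactly the prescribed δ_t (`capFunction_eq`).

For a continuous positive weight f, the floating body with relative cap heights about t f therefore
lies between the Wulff shapes ⟨G(x), y⟩ ≤ 1 - (1 ± ε) t f(x). In the coordinates G its polar is, to
first order, {x : g(x)(1 - t f(x)) ≤ 1} (`exists_polar_floatingBody_sandwich`). Integrating along
rays gives polar volume ∫_K J (1 - t f)^(-n), up to errors controlled by ε, so the derivative at 0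
is n ∫_K J f (`tendsto_volume_polar_quotient`). With f = φ(J)/J this is Φ(K).

If φ(κ₀) is merely measurable, it is truncated and approximated in L¹ of the cone measure by
continuous positive functions b_k. The weights b_k/J give difference quotients with limits ∫ b_k →
Φ(K), possibly infinite, and a diagonal choice of k as t → 0 gives the family (`exists_diagonal`).
-/

namespace PolarFloating

/-! ### The gauge of a body with C² boundary is C² off the origin. -/

variable {n : ℕ} {K : Set (Space n)}

/-- A convex body with the origin in its interior. -/
structure IsBody (K : Set (Space n)) : Prop where
  convex : Convex ℝ K
  isCompact : IsCompact K
  zero_mem : (0 : Space n) ∈ interior K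

namespace IsBody

lemma mem_nhds (hK : IsBody K) : K ∈ 𝓝 (0 : Space n) := mem_interior_iff_mem_nhds.1 hK.zero_mem

lemma absorbent (hK : IsBody K) : Absorbent ℝ K := absorbent_nhds_zero hK.mem_nhds

lemma continuous_gauge (hK : IsBody K) : Continuous (gauge K) :=
  _root_.continuous_gauge hK.convex hK.mem_nhds

lemma gauge_le_one_iff (hK : IsBody K) {x : Space n} : gauge K x ≤ 1 ↔ x ∈ K := by
  rw [gauge_le_one_iff_mem_closure hK.convex hK.mem_nhds, hK.isCompact.isClosed.closure_eq]

lemma mem_frontier_iff (hK : IsBody K) {x : Space n} : x ∈ frontier K ↔ gauge K x = 1 :=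
  (gauge_eq_one_iff_mem_frontier hK.convex hK.mem_nhds).symm

lemma gauge_pos (hK : IsBody K) {x : Space n} (hx : x ≠ 0) : 0 < gauge K x :=
  (_root_.gauge_pos hK.absorbent
    ((NormedSpace.isVonNBounded_iff ℝ).2 hK.isCompact.isBounded)).2 hx

lemma gauge_smul (_ : IsBody K) {t : ℝ} (ht : 0 ≤ t) (x : Space n) :
    gauge K (t • x) = t * gauge K x := by
  rw [gauge_smul_of_nonneg ht, smul_eq_mul]

lemma gauge_add_le (hK : IsBody K) (x y : Space n) :
    gauge K (x + y) ≤ gauge K x + gauge K y :=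
  _root_.gauge_add_le hK.convex hK.absorbent x y

lemma ne_zero (hK : IsBody K) {x : Space n} (hx : x ∈ frontier K) : x ≠ 0 := by
  rintro rfl
  rw [hK.mem_frontier_iff, gauge_zero] at hx
  exact zero_ne_one hx

lemma radial_mem (hK : IsBody K) {x : Space n} (hx : x ≠ 0) :
    (gauge K x)⁻¹ • x ∈ frontier K := by
  rw [hK.mem_frontier_iff, hK.gauge_smul (inv_nonneg.2 (gauge_nonneg x)),
    inv_mul_cancel₀ (hK.gauge_pos hx).ne']

lemma isCompact_frontier (hK : IsBody K) : IsCompact (frontier K) :=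
  hK.isCompact.of_isClosed_subset isClosed_frontier hK.isCompact.isClosed.frontier_subset

lemma continuousAt_radial (hK : IsBody K) {x : Space n} (hx : x ≠ 0) :
    ContinuousAt (fun y => (gauge K y)⁻¹ • y) x :=
  (hK.continuous_gauge.continuousAt.inv₀ (hK.gauge_pos hx).ne').smul continuousAt_id

/-- The gauge is differentiable at a boundary point at which the boundary lies in the zero set of
a differentiable function with radially increasing differential. -/
lemma hasFDerivAt_gauge (hK : IsBody K) {p : Space n} (hp : p ∈ frontier K) {F : Space n → ℝ}
    {F' : Space n →L[ℝ] ℝ} (hF : HasFDerivAt F F' p) (hpos : 0 < F' p)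
    (hzero : ∀ᶠ x in 𝓝 p, x ∈ frontier K → F x = 0) :
    HasFDerivAt (gauge K) ((F' p)⁻¹ • F') p := by
  have hp0 := hK.ne_zero hp
  have hgp : gauge K p = 1 := hK.mem_frontier_iff.1 hp
  set r : Space n → Space n := fun y => (gauge K y)⁻¹ • y with hr
  have hrp : r p = p := by simp [hr, hgp]
  have hrc : Tendsto r (𝓝 p) (𝓝 p) := by
    have := hK.continuousAt_radial hp0
    rw [ContinuousAt, ← hr] at this
    simpa only [hgp, inv_one, one_smul] using this
  obtain ⟨L, hL⟩ := hK.convex.lipschitz_gauge hK.mem_nhds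
  have hgO : (fun x => gauge K x - gauge K p) =O[𝓝 p] fun x => x - p :=
    Asymptotics.IsBigO.of_bound L (Eventually.of_forall fun x => hL.norm_sub_le x p)
  have hinv : (fun x => (gauge K x)⁻¹) =O[𝓝 p] fun _ => (1 : ℝ) :=
    (hK.continuous_gauge.continuousAt.inv₀ (hK.gauge_pos hp0).ne').isBigO_one ℝ
  have hev0 : ∀ᶠ x in 𝓝 p, x ≠ 0 := isOpen_ne.mem_nhds hp0
  have hrO : (fun x => r x - p) =O[𝓝 p] fun x => x - p := by
    have h1 : (fun x => (x - p) - (gauge K x - gauge K p) • p) =O[𝓝 p] fun x => x - p := by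
      refine (Asymptotics.isBigO_refl _ _).sub ?_
      refine Asymptotics.IsBigO.of_bound (L * ‖p‖) (Eventually.of_forall fun x => ?_)
      rw [norm_smul, mul_right_comm]
      gcongr
      exact hL.norm_sub_le x p
    have h2 := hinv.smul h1
    simp only [one_smul] at h2
    refine h2.congr' ?_ EventuallyEq.rfl
    filter_upwards [hev0] with x hx
    have : gauge K x ≠ 0 := (hK.gauge_pos hx).ne'
    simp only [hr, hgp, smul_sub, sub_smul, one_smul, smul_smul, inv_mul_cancel₀ this]
    abel
  -- F vanishes at p and at the radial projection r x, so linearising F gives F'(r x - p) = o(x -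
  -- p). Multiplying by g(x) turns this into F'(x) - g(x) F'(p) = o(x - p), the claimed expansion of
  -- g.
  have h3 : (fun x => F (r x) - F p - F' (r x - p)) =o[𝓝 p] fun x => x - p :=
    (hF.isLittleO.comp_tendsto hrc).trans_isBigO hrO
  have hFp : F p = 0 := hzero.self_of_nhds hp
  have h4 : (fun x => F' (r x - p)) =o[𝓝 p] fun x => x - p := by
    refine h3.neg_left.congr' ?_ EventuallyEq.rfl
    filter_upwards [hev0, hrc.eventually hzero] with x hx hx'
    rw [hx' (hK.radial_mem hx), hFp]
    ring
  have hgb : (gauge K) =O[𝓝 p] fun _ => (1 : ℝ) := hK.continuous_gauge.continuousAt.isBigO_one ℝ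
  have h5 := hgb.smul_isLittleO h4
  simp only [one_smul] at h5
  have h6 := h5.const_smul_left (-(F' p)⁻¹)
  refine .of_isLittleO ((h6.congr' ?_ EventuallyEq.rfl))
  filter_upwards [hev0] with x hx
  have : gauge K x ≠ 0 := (hK.gauge_pos hx).ne'
  simp only [hr, map_sub, map_smul, smul_eq_mul, hgp, smul_apply,
    Pi.smul_apply]
  field_simp
  ring

lemma eq_zero_of_mem_frontier (hK : IsBody K) {p : Space n} (hp : p ∈ frontier K)
    {F : Space n → ℝ} (hF : ContinuousAt F p) (hloc : ∀ᶠ x in 𝓝 p, (x ∈ K ↔ F x ≤ 0)) :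
    F p = 0 := by
  refine le_antisymm (hloc.self_of_nhds.1 (hK.isCompact.isClosed.frontier_subset hp)) ?_
  by_contra! hlt
  have : K ∈ 𝓝 p := by
    filter_upwards [hloc, hF.eventually (gt_mem_nhds hlt)] with x hx hx' using hx.2 hx'.le
  exact hp.2 (mem_interior_iff_mem_nhds.2 this)

lemma fderiv_sub_nonpos (hK : IsBody K) {p : Space n} (hp : p ∈ K)
    {F : Space n → ℝ} {F' : Space n →L[ℝ] ℝ} (hF : HasFDerivAt F F' p)
    (hmax : IsLocalMaxOn F K p) {y : Space n} (hy : y ∈ K) : F' (y - p) ≤ 0 :=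
  hmax.hasFDerivWithinAt_nonpos hF.hasFDerivWithinAt
    (sub_mem_posTangentConeAt_of_segment_subset (hK.convex.segment_subset hp hy))

/-- Choose v with F' v > 0. A small multiple t v lies in K because 0 is interior, and
`fderiv_sub_nonpos` at t v gives 0 < t F' v ≤ F' p. -/
lemma fderiv_self_pos (hK : IsBody K) {p : Space n} (hp : p ∈ K)
    {F : Space n → ℝ} {F' : Space n →L[ℝ] ℝ} (hF : HasFDerivAt F F' p) (hne : F' ≠ 0)
    (hmax : IsLocalMaxOn F K p) : 0 < F' p := by
  obtain ⟨v, hv⟩ : ∃ v, 0 < F' v := by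
    obtain ⟨v, hv⟩ := DFunLike.ne_iff.1 hne
    rcases lt_or_gt_of_ne hv with h | h
    · exact ⟨-v, by simpa using h⟩
    · exact ⟨v, h⟩
  have h0 : Tendsto (fun t : ℝ => t • v) (𝓝[>] 0) (𝓝 0) :=
    ((continuous_id.smul continuous_const).tendsto' 0 0 (by simp)).mono_left nhdsWithin_le_nhds
  obtain ⟨t, ht, ht0⟩ := ((h0.eventually hK.mem_nhds).and self_mem_nhdsWithin).exists
  have := hK.fderiv_sub_nonpos hp hF hmax ht
  rw [map_sub, map_smul, smul_eq_mul] at this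
  have : 0 < t * F' v := mul_pos ht0 hv
  linarith

/-- A bootstrap: near p the derivative of g is Λ ∘ r, where r is the radial projection and Λ(x) =
F'(x)/F'(x)x is C¹. Since r is continuous, g is C¹; then r is C¹, so Λ ∘ r is C¹ and g is C². -/
lemma contDiffAt_gauge_of_mem_frontier (hK : IsBody K) (hC : HasC2Boundary K) {p : Space n}
    (hp : p ∈ frontier K) : ContDiffAt ℝ 2 (gauge K) p := by
  obtain ⟨F, hF, hF0, hloc⟩ := hC p hp
  have hp0 := hK.ne_zero hp
  set r : Space n → Space n := fun y => (gauge K y)⁻¹ • y with hr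
  have hrp : r p = p := by simp [hr, hK.mem_frontier_iff.1 hp]
  have hrc : ContinuousAt r p := hK.continuousAt_radial hp0
  have hF1 : ContDiffAt ℝ 1 (fderiv ℝ F) p := hF.fderiv_right (by norm_num)
  have hmaxx : ∀ x ∈ frontier K, ContinuousAt F x → (∀ᶠ y in 𝓝 x, (y ∈ K ↔ F y ≤ 0)) →
      IsLocalMaxOn F K x := by
    intro x hx hFx hlx
    have h0 := hK.eq_zero_of_mem_frontier hx hFx hlx
    have := nhdsWithin_le_nhds (s := K) hlx
    filter_upwards [this, self_mem_nhdsWithin] with y hy hyK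
    rw [h0]
    exact hy.1 hyK
  have hev : ∀ᶠ x in 𝓝 p, ContDiffAt ℝ 2 F x ∧ fderiv ℝ F x ≠ 0 ∧
      ∀ᶠ y in 𝓝 x, ContDiffAt ℝ 2 F y ∧ ∀ᶠ z in 𝓝 y, (z ∈ K ↔ F z ≤ 0) :=
    (hF.eventually (by decide)).and <| (hF1.continuousAt.eventually_ne hF0).and
      ((hF.eventually (by decide)).and hloc.eventually_nhds).eventually_nhds
  have hder : ∀ x ∈ frontier K, (ContDiffAt ℝ 2 F x ∧ fderiv ℝ F x ≠ 0 ∧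
      ∀ᶠ y in 𝓝 x, ContDiffAt ℝ 2 F y ∧ ∀ᶠ z in 𝓝 y, (z ∈ K ↔ F z ≤ 0)) →
      0 < fderiv ℝ F x x ∧
        HasFDerivAt (gauge K) ((fderiv ℝ F x x)⁻¹ • fderiv ℝ F x) x := by
    rintro x hx ⟨hFx, hne, hlx⟩
    have hd : HasFDerivAt F (fderiv ℝ F x) x := (hFx.differentiableAt (by norm_num)).hasFDerivAt
    have hpos := hK.fderiv_self_pos (hK.isCompact.isClosed.frontier_subset hx) hd hne
      (hmaxx x hx hFx.continuousAt hlx.self_of_nhds.2)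
    refine ⟨hpos, hK.hasFDerivAt_gauge hx hd hpos ?_⟩
    filter_upwards [hlx] with y hy hyf using hK.eq_zero_of_mem_frontier hyf hy.1.continuousAt hy.2
  set Λ : Space n → Space n →L[ℝ] ℝ := fun x => (fderiv ℝ F x x)⁻¹ • fderiv ℝ F x with hΛ
  have hpos := (hder p hp hev.self_of_nhds).1
  have hΛ1 : ContDiffAt ℝ 1 Λ p :=
    ((hF1.clm_apply contDiffAt_id).inv hpos.ne').smul hF1
  have hgr : ∀ᶠ q in 𝓝 p, HasFDerivAt (gauge K) (Λ (r q)) q := by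
    have hrc' : Tendsto r (𝓝 p) (𝓝 p) := by
      have := hrc.tendsto
      rwa [hrp] at this
    have hne : ∀ᶠ q in 𝓝 p, q ≠ 0 := isOpen_ne.mem_nhds hp0
    filter_upwards [hrc'.eventually hev, hne] with q hq hq0
    have h := (hder (r q) (hK.radial_mem hq0) hq).2
    have hg : 0 < gauge K q := hK.gauge_pos hq0
    have hlin : HasFDerivAt (fun y : Space n => (gauge K q)⁻¹ • y)
        ((gauge K q)⁻¹ • ContinuousLinearMap.id ℝ (Space n)) q :=
      ((gauge K q)⁻¹ • ContinuousLinearMap.id ℝ (Space n)).hasFDerivAt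
    have h2 := (HasFDerivAt.comp (g := gauge K) (f := fun y => (gauge K q)⁻¹ • y) q h
      hlin).const_smul (gauge K q)
    refine (h2.congr_fderiv ?_).congr_of_eventuallyEq (Eventually.of_forall fun y => ?_)
    · ext v
      simp [hΛ]
      field_simp
    · simp only [Pi.smul_apply, Function.comp_apply, smul_eq_mul]
      rw [hK.gauge_smul (inv_nonneg.2 hg.le), mul_inv_cancel_left₀ hg.ne']
  have hΛr : ContinuousAt (fun q => Λ (r q)) p := by
    refine ContinuousAt.comp (g := Λ) ?_ hrc
    rw [hrp]
    exact hΛ1.continuousAt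
  have hC1 : ContDiffAt ℝ 1 (gauge K) p := by
    have hfd : ContinuousAt (fderiv ℝ (gauge K)) p :=
      hΛr.congr (hgr.mono fun q hq => hq.fderiv.symm)
    rw [contDiffAt_one_iff]
    have hcont : ∀ᶠ q in 𝓝 p, ContinuousAt (fun q => Λ (r q)) q := by
      have hne : ∀ᶠ q in 𝓝 p, q ≠ 0 := isOpen_ne.mem_nhds hp0
      have hrc' : Tendsto r (𝓝 p) (𝓝 p) := by
        have := hrc.tendsto
        rwa [hrp] at this
      filter_upwards [hne, hrc'.eventually (hΛ1.eventually (by decide))] with q hq hq'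
      exact ContinuousAt.comp (g := Λ) hq'.continuousAt (hK.continuousAt_radial hq)
    exact ⟨fun q => Λ (r q), _, hgr.and hcont, fun q hq => hq.2.continuousWithinAt,
      fun q hq => hq.1⟩
  have hr1 : ContDiffAt ℝ 1 r p :=
    (hC1.inv (hK.gauge_pos hp0).ne').smul contDiffAt_id
  have h2 : ContDiffAt ℝ 1 (fun q => Λ (r q)) p := by
    refine ContDiffAt.comp (g := Λ) p ?_ hr1
    rwa [hrp]
  exact (contDiffAt_succ_iff_hasFDerivAt (n := 1)).2 ⟨fun q => Λ (r q), ⟨_, hgr, fun q hq => hq⟩, h2⟩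

lemma contDiffAt_gauge (hK : IsBody K) (hC : HasC2Boundary K) {x : Space n} (hx : x ≠ 0) :
    ContDiffAt ℝ 2 (gauge K) x := by
  have hg := hK.gauge_pos hx
  have h1 := hK.contDiffAt_gauge_of_mem_frontier hC (hK.radial_mem hx)
  have h2 : ContDiffAt ℝ 2 (fun y => gauge K x • gauge K ((gauge K x)⁻¹ • y)) x :=
    ContDiffAt.const_smul _ (ContDiffAt.comp (g := gauge K) (f := fun y => (gauge K x)⁻¹ • y) x h1
      (contDiffAt_id.const_smul _))
  refine h2.congr_of_eventuallyEq (Eventually.of_forall fun y => ?_)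
  simp only [smul_eq_mul]
  rw [hK.gauge_smul (inv_nonneg.2 hg.le), mul_inv_cancel_left₀ hg.ne']

end IsBody
end PolarFloating

/-! ### The duality map: homogeneity, monotonicity, relation to normals. -/

namespace PolarFloating

variable {n : ℕ} {K : Set (Space n)}

/-- A convex body with the origin in its interior whose gauge is of class `C²` off the origin. -/
structure IsSmoothBody (K : Set (Space n)) : Prop extends IsBody K where
  contDiffAt : ∀ x : Space n, x ≠ 0 → ContDiffAt ℝ 2 (gauge K) x

lemma IsBody.isSmoothBody (hK : IsBody K) (hC : HasC2Boundary K) : IsSmoothBody K :=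
  ⟨hK, fun _ hx => hK.contDiffAt_gauge hC hx⟩

/-- The gradient of `gauge K ^ 2 / 2`. -/
noncomputable def dualityMap (K : Set (Space n)) (x : Space n) : Space n :=
  gauge K x • gradient (gauge K) x

namespace IsSmoothBody

lemma hasGradientAt (hK : IsSmoothBody K) {x : Space n} (hx : x ≠ 0) :
    HasGradientAt (gauge K) (gradient (gauge K) x) x :=
  ((hK.contDiffAt x hx).differentiableAt (by norm_num)).hasGradientAt

lemma hasDerivAt_line (hK : IsSmoothBody K) {x : Space n} (hx : x ≠ 0) (v : Space n) :
    HasDerivAt (fun t : ℝ => gauge K (x + t • v)) ⟪gradient (gauge K) x, v⟫ 0 := by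
  have h1 : HasDerivAt (fun t : ℝ => x + t • v) v 0 := by
    simpa using ((hasDerivAt_id (0 : ℝ)).smul_const v).const_add x
  have h2 : HasFDerivAt (gauge K) (InnerProductSpace.toDual ℝ _ (gradient (gauge K) x))
      (x + (0 : ℝ) • v) := by
    simpa using (hK.hasGradientAt hx).hasFDerivAt
  exact h2.comp_hasDerivAt (0 : ℝ) h1

lemma inner_gradient_self (hK : IsSmoothBody K) {x : Space n} (hx : x ≠ 0) :
    ⟪gradient (gauge K) x, x⟫ = gauge K x := by
  have h1 := hK.hasDerivAt_line hx x
  have h2 : HasDerivAt (fun t : ℝ => (1 + t) * gauge K x) (gauge K x) 0 := by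
    simpa using ((hasDerivAt_id (0 : ℝ)).const_add 1).mul_const (gauge K x)
  refine h1.unique (h2.congr_of_eventuallyEq ?_)
  have : ∀ᶠ t : ℝ in 𝓝 0, -1 < t := lt_mem_nhds (by norm_num)
  filter_upwards [this] with t ht
  rw [← hK.gauge_smul (by linarith), add_smul, one_smul]

/-- Subadditivity bounds every right difference quotient of g at x in direction y by g(y). -/
lemma inner_gradient_le (hK : IsSmoothBody K) {x : Space n} (hx : x ≠ 0) (y : Space n) :
    ⟪gradient (gauge K) x, y⟫ ≤ gauge K y := by
  refine le_of_tendsto (hK.hasDerivAt_line hx y).tendsto_slope_zero_right ?_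
  filter_upwards [self_mem_nhdsWithin] with t ht
  have ht : 0 < t := ht
  have := hK.gauge_add_le x (t • y)
  rw [hK.gauge_smul ht.le] at this
  simp only [zero_add, zero_smul, add_zero, smul_eq_mul]
  rw [inv_mul_le_iff₀ ht]
  linarith

lemma gradient_smul (hK : IsSmoothBody K) {x : Space n} (hx : x ≠ 0) {t : ℝ} (ht : 0 < t) :
    gradient (gauge K) (t • x) = gradient (gauge K) x := by
  refine ext_inner_right ℝ fun v => ?_
  have htx : t • x ≠ 0 := smul_ne_zero ht.ne' hx
  have h1 := hK.hasDerivAt_line htx (t • v)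
  have h2 := (hK.hasDerivAt_line hx v).const_mul t
  have h3 : (fun s : ℝ => gauge K (t • x + s • t • v)) = fun s => t * gauge K (x + s • v) := by
    funext s
    rw [← hK.gauge_smul ht.le, smul_add, smul_comm t s]
  rw [h3] at h1
  have := h1.unique h2
  rw [inner_smul_right] at this
  exact mul_left_cancel₀ ht.ne' this

lemma dualityMap_smul (hK : IsSmoothBody K) {x : Space n} (hx : x ≠ 0) {t : ℝ} (ht : 0 < t) :
    dualityMap K (t • x) = t • dualityMap K x := by
  rw [dualityMap, hK.gradient_smul hx ht, hK.gauge_smul ht.le, mul_smul, dualityMap]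

lemma inner_dualityMap_self (hK : IsSmoothBody K) {x : Space n} (hx : x ≠ 0) :
    ⟪dualityMap K x, x⟫ = gauge K x ^ 2 := by
  rw [dualityMap, real_inner_smul_left, hK.inner_gradient_self hx, sq]

lemma inner_dualityMap_le (hK : IsSmoothBody K) {x : Space n} (hx : x ≠ 0) (y : Space n) :
    ⟪dualityMap K x, y⟫ ≤ gauge K x * gauge K y := by
  rw [dualityMap, real_inner_smul_left]
  exact mul_le_mul_of_nonneg_left (hK.inner_gradient_le hx y) (gauge_nonneg x)

lemma dualityMap_ne_zero (hK : IsSmoothBody K) {x : Space n} (hx : x ≠ 0) :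
    dualityMap K x ≠ 0 := by
  intro h
  have := hK.inner_dualityMap_self hx
  rw [h, inner_zero_left] at this
  exact (pow_pos (hK.gauge_pos hx) 2).ne this

lemma contDiffAt_dualityMap (hK : IsSmoothBody K) {x : Space n} (hx : x ≠ 0) :
    ContDiffAt ℝ 1 (dualityMap K) x := by
  have h1 : ContDiffAt ℝ 1 (gradient (gauge K)) x :=
    ((InnerProductSpace.toDual ℝ (Space n)).symm.contDiff.contDiffAt).comp x
      ((hK.contDiffAt x hx).fderiv_right (by norm_num))
  exact ((hK.contDiffAt x hx).of_le (by norm_num)).smul h1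

lemma hasFDerivAt_dualityMap (hK : IsSmoothBody K) {x : Space n} (hx : x ≠ 0) :
    HasFDerivAt (dualityMap K) (fderiv ℝ (dualityMap K) x) x :=
  ((hK.contDiffAt_dualityMap hx).differentiableAt (by norm_num)).hasFDerivAt

lemma continuousAt_fderiv_dualityMap (hK : IsSmoothBody K) {x : Space n} (hx : x ≠ 0) :
    ContinuousAt (fderiv ℝ (dualityMap K)) x :=
  ((hK.contDiffAt_dualityMap hx).fderiv_right (m := 0) (by norm_num)).continuousAt

lemma hasFDerivAt_half_sq (hK : IsSmoothBody K) {x : Space n} (hx : x ≠ 0) :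
    HasFDerivAt (fun y => gauge K y ^ 2 / 2) (innerSL ℝ (dualityMap K x)) x := by
  have := ((hK.hasGradientAt hx).hasFDerivAt.pow 2).mul_const (2⁻¹ : ℝ)
  refine this.congr_fderiv ?_
  ext v
  simp [dualityMap]
  ring

lemma fderiv_dualityMap_self (hK : IsSmoothBody K) {x : Space n} (hx : x ≠ 0) :
    fderiv ℝ (dualityMap K) x x = dualityMap K x := by
  have h1 : HasDerivAt (fun t : ℝ => t • x) x 1 := by
    simpa using (hasDerivAt_id (1 : ℝ)).smul_const x
  have h2 : HasFDerivAt (dualityMap K) (fderiv ℝ (dualityMap K) x) ((1 : ℝ) • x) := by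
    rw [one_smul]
    exact hK.hasFDerivAt_dualityMap hx
  have h3 : HasDerivAt (fun t : ℝ => t • dualityMap K x) (dualityMap K x) 1 := by
    simpa using (hasDerivAt_id (1 : ℝ)).smul_const (dualityMap K x)
  refine (h2.comp_hasDerivAt (1 : ℝ) h1).unique (h3.congr_of_eventuallyEq ?_)
  filter_upwards [lt_mem_nhds (zero_lt_one (α := ℝ))] with t ht
  simp [hK.dualityMap_smul hx ht]

lemma fderiv_dualityMap_smul (hK : IsSmoothBody K) {x : Space n} (hx : x ≠ 0) {t : ℝ}
    (ht : 0 < t) : fderiv ℝ (dualityMap K) (t • x) = fderiv ℝ (dualityMap K) x := by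
  have htx : t • x ≠ 0 := smul_ne_zero ht.ne' hx
  have h1 : HasFDerivAt (fun y : Space n => t • y) (t • ContinuousLinearMap.id ℝ (Space n)) x :=
    (t • ContinuousLinearMap.id ℝ (Space n)).hasFDerivAt
  have h2 := HasFDerivAt.comp (g := dualityMap K) (f := fun y : Space n => t • y) x
    (hK.hasFDerivAt_dualityMap htx) h1
  have h3 := (hK.hasFDerivAt_dualityMap hx).const_smul t
  have h4 := h2.unique (h3.congr_of_eventuallyEq (by
    filter_upwards [isOpen_ne.mem_nhds hx] with y hy
    exact hK.dualityMap_smul hy ht))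
  ext1 v
  have := congrArg (fun f : Space n →L[ℝ] Space n => f v) h4
  simp only [ContinuousLinearMap.comp_apply, smul_apply, ContinuousLinearMap.id_apply,
    map_smul] at this
  exact smul_right_injective _ ht.ne' this

/-- The derivative of the duality map is the Hessian of g²/2. -/
lemma inner_fderiv_dualityMap_comm (hK : IsSmoothBody K) {x : Space n} (hx : x ≠ 0)
    (v w : Space n) :
    ⟪fderiv ℝ (dualityMap K) x v, w⟫ = ⟪v, fderiv ℝ (dualityMap K) x w⟫ := by
  have h := second_derivative_symmetric_of_eventually (f := fun y => gauge K y ^ 2 / 2)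
    (f' := fun y => innerSL ℝ (dualityMap K y)) (x := x)
    (f'' := (innerSL ℝ).comp (fderiv ℝ (dualityMap K) x)) (by
      filter_upwards [isOpen_ne.mem_nhds hx] with y hy using hK.hasFDerivAt_half_sq hy)
    ((innerSL ℝ).hasFDerivAt.comp x (hK.hasFDerivAt_dualityMap hx)) v w
  simpa [real_inner_comm] using h

/-- Euler's identity and the support inequality bound the pairing below by (g(x) - g(y))². This
monotonicity makes the derivative of the duality map positive semidefinite. -/
lemma inner_dualityMap_sub_nonneg (hK : IsSmoothBody K) {x y : Space n} (hx : x ≠ 0)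
    (hy : y ≠ 0) : 0 ≤ ⟪dualityMap K y - dualityMap K x, y - x⟫ := by
  have h1 := hK.inner_dualityMap_self hx
  have h2 := hK.inner_dualityMap_self hy
  have h3 := hK.inner_dualityMap_le hx y
  have h4 := hK.inner_dualityMap_le hy x
  rw [inner_sub_left, inner_sub_right, inner_sub_right]
  nlinarith [sq_nonneg (gauge K x - gauge K y)]

lemma inner_fderiv_dualityMap_nonneg (hK : IsSmoothBody K) {x : Space n} (hx : x ≠ 0)
    (v : Space n) : 0 ≤ ⟪fderiv ℝ (dualityMap K) x v, v⟫ := by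
  have h1 : HasDerivAt (fun t : ℝ => x + t • v) v 0 := by
    simpa using ((hasDerivAt_id (0 : ℝ)).smul_const v).const_add x
  have h2 : HasFDerivAt (dualityMap K) (fderiv ℝ (dualityMap K) x) (x + (0 : ℝ) • v) := by
    simpa using hK.hasFDerivAt_dualityMap hx
  have h3 := (h2.comp_hasDerivAt (0 : ℝ) h1).tendsto_slope_zero_right
  have h4 := h3.inner (𝕜 := ℝ) (tendsto_const_nhds (x := v))
  refine ge_of_tendsto h4 ?_
  have hne : ∀ᶠ t : ℝ in 𝓝[>] 0, x + t • v ≠ 0 := by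
    have : Tendsto (fun t : ℝ => x + t • v) (𝓝[>] 0) (𝓝 x) := by
      simpa using h1.continuousAt.tendsto.mono_left nhdsWithin_le_nhds
    exact this.eventually_ne hx
  filter_upwards [hne, self_mem_nhdsWithin] with t ht ht0
  have ht0 : 0 < t := ht0
  have := hK.inner_dualityMap_sub_nonneg hx ht
  rw [add_sub_cancel_left, inner_smul_right] at this
  simp only [Function.comp_apply, zero_add, zero_smul, add_zero, real_inner_smul_left]
  have h5 := nonneg_of_mul_nonneg_right this ht0
  positivity

/-- If u is normal at p, then y ↦ ⟨p, u⟩ g(y) - ⟨y, u⟩ is nonnegative and vanishes at p. Its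
derivative there is zero, so u is a nonnegative multiple of the gradient of g; the unit length fixes
the factor. -/
lemma isOuterUnitNormal_iff (hK : IsSmoothBody K) {p u : Space n} (hp : p ∈ frontier K) :
    IsOuterUnitNormal K p u ↔ u = ‖dualityMap K p‖⁻¹ • dualityMap K p := by
  have hp0 := hK.ne_zero hp
  have hgp : gauge K p = 1 := hK.mem_frontier_iff.1 hp
  have hG0 := hK.dualityMap_ne_zero hp0
  have hGp : dualityMap K p = gradient (gauge K) p := by rw [dualityMap, hgp, one_smul]
  have hGpp : ⟪dualityMap K p, p⟫ = 1 := by rw [hK.inner_dualityMap_self hp0, hgp, one_pow]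
  constructor
  · rintro ⟨hu, hmax⟩
    have h0 : 0 ≤ ⟪p, u⟫ := by
      simpa using hmax 0 (interior_subset hK.zero_mem)
    have hle : ∀ y, ⟪y, u⟫ ≤ ⟪p, u⟫ * gauge K y := by
      intro y
      rcases eq_or_ne y 0 with rfl | hy
      · simp
      · have := hmax _ (hK.isCompact.isClosed.frontier_subset (hK.radial_mem hy))
        rw [real_inner_smul_left, inv_mul_le_iff₀ (hK.gauge_pos hy)] at this
        linarith
    have hd : HasFDerivAt (fun y => ⟪p, u⟫ * gauge K y - ⟪y, u⟫)
        (⟪p, u⟫ • InnerProductSpace.toDual ℝ _ (gradient (gauge K) p) - innerSL ℝ u) p := by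
      refine ((hK.hasGradientAt hp0).hasFDerivAt.const_mul _).sub ?_
      refine (innerSL ℝ u).hasFDerivAt.congr_of_eventuallyEq (Eventually.of_forall fun y => ?_)
      simp [real_inner_comm]
    have hmin : IsLocalMin (fun y => ⟪p, u⟫ * gauge K y - ⟪y, u⟫) p := by
      refine Eventually.of_forall fun y => ?_
      simp only [hgp]
      linarith [hle y]
    have hz := hmin.hasFDerivAt_eq_zero hd
    have hu' : u = ⟪p, u⟫ • dualityMap K p := by
      refine ext_inner_right ℝ fun v => ?_
      have := congrArg (fun f : Space n →L[ℝ] ℝ => f v) hz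
      simp only [sub_apply, smul_apply, InnerProductSpace.toDual_apply_apply, innerSL_apply_apply,
        zero_apply, smul_eq_mul] at this
      rw [real_inner_smul_left, hGp]
      linarith
    have h1 : 1 = ⟪p, u⟫ * ‖dualityMap K p‖ := by
      rw [← hu]
      nth_rewrite 1 [hu']
      rw [norm_smul, Real.norm_of_nonneg h0]
    rw [eq_inv_of_mul_eq_one_left h1.symm] at hu'
    exact hu'
  · rintro rfl
    have hn : 0 < ‖dualityMap K p‖ := norm_pos_iff.2 hG0
    refine ⟨by rw [norm_smul, norm_inv, norm_norm, inv_mul_cancel₀ hn.ne'], fun y hy => ?_⟩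
    rw [inner_smul_right, inner_smul_right, real_inner_comm, real_inner_comm (dualityMap K p) p, hGpp]
    refine mul_le_mul_of_nonneg_left ?_ (inv_nonneg.2 hn.le)
    refine (hK.inner_dualityMap_le hp0 y).trans ?_
    rw [hgp, one_mul]
    exact hK.gauge_le_one_iff.2 hy

lemma gaussMap_eq (hK : IsSmoothBody K) {p : Space n} (hp : p ∈ frontier K) :
    gaussMap K p = ‖dualityMap K p‖⁻¹ • dualityMap K p :=
  (hK.isOuterUnitNormal_iff hp).1
    (Classical.epsilon_spec ⟨_, (hK.isOuterUnitNormal_iff hp).2 rfl⟩)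

lemma inner_gaussMap (hK : IsSmoothBody K) {p : Space n} (hp : p ∈ frontier K) :
    ⟪p, gaussMap K p⟫ = ‖dualityMap K p‖⁻¹ := by
  rw [hK.gaussMap_eq hp, inner_smul_right, real_inner_comm,
    hK.inner_dualityMap_self (hK.ne_zero hp), hK.mem_frontier_iff.1 hp, one_pow, mul_one]

end IsSmoothBody
end PolarFloating

/-! ### Determinants, and the centro-affine curvature as a Jacobian. -/

namespace PolarFloating

section LinearAlgebra

variable {E : Type*} [NormedAddCommGroup E] [InnerProductSpace ℝ E] [FiniteDimensional ℝ E]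

/-- The compression of an endomorphism to the orthogonal complement of a vector. -/
noncomputable def compressOrthogonal (ν : E) (M : E →ₗ[ℝ] E) : (ℝ ∙ ν)ᗮ →ₗ[ℝ] (ℝ ∙ ν)ᗮ :=
  ((ℝ ∙ ν)ᗮ.orthogonalProjectionOnto : E →ₗ[ℝ] (ℝ ∙ ν)ᗮ) ∘ₗ M ∘ₗ (ℝ ∙ ν)ᗮ.subtype

/-- M is block triangular for the invariant line ℝν. The compression is the map induced on the
quotient by that line, identified with the orthogonal complement. -/
lemma det_eq_mul_det_compressOrthogonal {ν : E} (hν : ν ≠ 0) {M : E →ₗ[ℝ] E} {c : ℝ}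
    (hM : M ν = c • ν) : LinearMap.det M = c * LinearMap.det (compressOrthogonal ν M) := by
  have hW : ∀ w ∈ (ℝ ∙ ν), M w = c • w := by
    intro w hw
    obtain ⟨a, rfl⟩ := Submodule.mem_span_singleton.1 hw
    rw [map_smul, hM, smul_comm]
  have he : (ℝ ∙ ν) ≤ (ℝ ∙ ν).comap M := fun w hw => by
    rw [Submodule.mem_comap, hW w hw]
    exact Submodule.smul_mem _ _ hw
  rw [LinearMap.det_eq_det_mul_det (ℝ ∙ ν) M he]
  congr 1
  · have : M.restrict (p := ℝ ∙ ν) (q := ℝ ∙ ν) he = c • LinearMap.id := by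
      ext w
      simp [hW w w.2]
    rw [this, LinearMap.det_smul, LinearMap.det_id, finrank_span_singleton hν, pow_one, mul_one]
  · have hc : IsCompl (ℝ ∙ ν) (ℝ ∙ ν)ᗮ := Submodule.isCompl_orthogonal _
    set e := Submodule.quotientEquivOfIsCompl _ _ hc
    have hmk : ∀ y : E, e (Submodule.Quotient.mk y) = (ℝ ∙ ν)ᗮ.orthogonalProjectionOnto y := by
      intro y
      rw [← LinearEquiv.eq_symm_apply, Submodule.quotientEquivOfIsCompl_symm_apply,
        Submodule.Quotient.eq]
      have := Submodule.sub_starProjection_mem_orthogonal (K := (ℝ ∙ ν)ᗮ) y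
      rwa [Submodule.orthogonal_orthogonal] at this
    rw [← LinearMap.det_conj ((ℝ ∙ ν).mapQ (ℝ ∙ ν) M he) e]
    congr 1
    ext1 v
    simp only [LinearMap.comp_apply, LinearEquiv.coe_coe, e,
      Submodule.quotientEquivOfIsCompl_symm_apply]
    erw [Submodule.mapQ_apply]
    exact hmk _

lemma det_adjoint_real (Q : E →ₗ[ℝ] E) :
    LinearMap.det (LinearMap.adjoint Q) = LinearMap.det Q := by
  have b := stdOrthonormalBasis ℝ E
  rw [← LinearMap.det_toMatrix b.toBasis, LinearMap.toMatrix_adjoint b b,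
    Matrix.det_conjTranspose, star_trivial, LinearMap.det_toMatrix]

/-- The rank-one perturbation P of the identity sends ν to p and fixes the complement of ν, so det P
= ⟨p, ν⟩. M ∘ P has ν as an eigenvector and the same compression as M. The lemma is needed because
G'(p) maps p, not ν, to a multiple of ν. -/
lemma inner_mul_det_eq {ν p : E} (hν : ‖ν‖ = 1) {M : E →ₗ[ℝ] E} {c : ℝ} (hM : M p = c • ν) :
    ⟪p, ν⟫ * LinearMap.det M = c * LinearMap.det (compressOrthogonal ν M) := by
  have hν0 : ν ≠ 0 := norm_ne_zero_iff.1 (by rw [hν]; exact one_ne_zero)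
  have hνν : ⟪ν, ν⟫ = 1 := by rw [real_inner_self_eq_norm_sq, hν, one_pow]
  set P : E →ₗ[ℝ] E := LinearMap.id + ((innerSL ℝ ν : E →L[ℝ] ℝ) : E →ₗ[ℝ] ℝ).smulRight (p - ν)
    with hP
  set Q : E →ₗ[ℝ] E := LinearMap.id + ((innerSL ℝ (p - ν) : E →L[ℝ] ℝ) : E →ₗ[ℝ] ℝ).smulRight ν
    with hQ
  -- P need not preserve ℝν, but its adjoint Q does, so the previous determinant formula applies to
  -- Q.
  have hPQ : P = LinearMap.adjoint Q := by
    rw [LinearMap.eq_adjoint_iff]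
    intro x y
    simp only [hP, hQ, LinearMap.add_apply, LinearMap.id_apply, LinearMap.smulRight_apply,
      ContinuousLinearMap.coe_coe, innerSL_apply_apply, inner_add_left, inner_add_right,
      real_inner_smul_left, inner_smul_right, real_inner_comm ν x]
    ring
  have hdetP : LinearMap.det P = ⟪p, ν⟫ := by
    have h1 : LinearMap.det P = LinearMap.det Q := by
      rw [hPQ, det_adjoint_real]
    have h2 : Q ν = ⟪p, ν⟫ • ν := by
      simp [hQ, sub_smul, hν]
    rw [h1, det_eq_mul_det_compressOrthogonal hν0 h2]
    have h3 : compressOrthogonal ν Q = LinearMap.id := by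
      ext1 v
      simp only [compressOrthogonal, LinearMap.comp_apply, hQ, LinearMap.add_apply,
        LinearMap.id_apply, LinearMap.smulRight_apply, Submodule.subtype_apply, map_add, map_smul]
      have hz : (ℝ ∙ ν)ᗮ.orthogonalProjectionOnto ν = 0 := by
        rw [Submodule.orthogonalProjectionOnto_eq_zero_iff, Submodule.orthogonal_orthogonal]
        exact Submodule.mem_span_singleton_self ν
      simp [hz]
    rw [h3, LinearMap.det_id, mul_one]
  have hMP : (M ∘ₗ P) ν = c • ν := by
    simp [hP, hν, hM]
  rw [← hdetP, mul_comm, ← LinearMap.det_comp, det_eq_mul_det_compressOrthogonal hν0 hMP]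
  congr 2
  ext1 v
  have : P v = v := by
    have := Submodule.mem_orthogonal_singleton_iff_inner_right.1 v.2
    simp [hP, this]
  simp [compressOrthogonal, this]

end LinearAlgebra

variable {n : ℕ} {K : Set (Space n)}

namespace IsSmoothBody

/-- The gauge along p + t v is 1 + o(t), so projecting this line radially to the boundary gives a
curve with velocity v. -/
lemma mem_tangentConeAt (hK : IsSmoothBody K) {p v : Space n} (hp : p ∈ frontier K)
    (hv : ⟪dualityMap K p, v⟫ = 0) : v ∈ tangentConeAt ℝ (frontier K) p := by
  have hp0 := hK.ne_zero hp
  have hgp : gauge K p = 1 := hK.mem_frontier_iff.1 hp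
  have hGp : dualityMap K p = gradient (gauge K) p := by rw [dualityMap, hgp, one_smul]
  have hd := hK.hasDerivAt_line hp0 v
  rw [← hGp, hv] at hd
  have hl : HasDerivAt (fun t : ℝ => p + t • v) v 0 := by
    simpa using ((hasDerivAt_id (0 : ℝ)).smul_const v).const_add p
  have hc : HasDerivAt (fun t : ℝ => (gauge K (p + t • v))⁻¹ • (p + t • v)) v 0 := by
    have := (hd.fun_inv (by simp [hgp])).smul hl
    simpa only [zero_smul, add_zero, hgp, inv_one, neg_zero, one_pow, div_one, one_smul] using! this
  have hcont : Tendsto (fun t : ℝ => p + t • v) (𝓝[>] 0) (𝓝 p) := by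
    simpa using hl.continuousAt.tendsto.mono_left nhdsWithin_le_nhds
  refine mem_tangentConeAt_of_seq (𝓝[>] (0 : ℝ)) (fun t => t⁻¹)
    (fun t => (gauge K (p + t • v))⁻¹ • (p + t • v) - p) ?_ ?_ ?_
  · have := (hc.continuousAt.tendsto.mono_left (nhdsWithin_le_nhds (s := Set.Ioi 0))).sub_const p
    simpa [hgp] using this
  · filter_upwards [hcont.eventually_ne hp0] with t ht
    simpa using hK.radial_mem ht
  · simpa [hgp] using hc.tendsto_slope_zero_right

/-- On the boundary the Gauss map is G/‖G‖. Differentiating the factor 1/‖G‖ produces a multiple of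
G(p), which the projection kills; what remains is ‖G(p)‖⁻¹ G'(p) on a space of dimension n - 1. -/
lemma gaussCurvature_eq (hK : IsSmoothBody K) {p : Space n} (hp : p ∈ frontier K) :
    gaussCurvature K p = ‖dualityMap K p‖⁻¹ ^ (n - 1) *
      LinearMap.det (compressOrthogonal (gaussMap K p)
        (fderiv ℝ (dualityMap K) p : Space n →ₗ[ℝ] Space n)) := by
  have hp0 := hK.ne_zero hp
  have hG0 := hK.dualityMap_ne_zero hp0
  set G := dualityMap K
  have hn : ‖G p‖ ≠ 0 := norm_ne_zero_iff.2 hG0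
  have hB : HasFDerivAt G (fderiv ℝ G p) p := hK.hasFDerivAt_dualityMap hp0
  have hnorm : DifferentiableAt ℝ (fun x => ‖G x‖⁻¹) p :=
    (hB.differentiableAt.norm ℝ hG0).inv hn
  have hN := hnorm.hasFDerivAt.smul hB
  have hW : HasFDerivWithinAt (gaussMap K) _ (frontier K) p :=
    hN.hasFDerivWithinAt.congr (fun x hx => hK.gaussMap_eq hx) (hK.gaussMap_eq hp)
  have hD := hW.differentiableWithinAt.hasFDerivWithinAt
  have hG_smul : G p = ‖G p‖ • gaussMap K p := by
    rw [hK.gaussMap_eq hp, smul_smul, mul_inv_cancel₀ hn, one_smul]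
  have hν0 : gaussMap K p ≠ 0 := by
    intro h
    rw [h, smul_zero] at hG_smul
    exact hG0 hG_smul
  have hrank : Module.finrank ℝ (ℝ ∙ gaussMap K p)ᗮ = n - 1 := by
    have h1 := Submodule.finrank_add_finrank_orthogonal (ℝ ∙ gaussMap K p)
    rw [finrank_span_singleton hν0, finrank_euclideanSpace_fin] at h1
    omega
  rw [gaussCurvature, ← hrank, ← LinearMap.det_smul]
  simp only
  congr 1
  ext1 v
  have hv : ⟪G p, v⟫ = 0 := by
    rw [hG_smul, real_inner_smul_left,
      Submodule.mem_orthogonal_singleton_iff_inner_right.1 v.2, mul_zero]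
  have hz : (ℝ ∙ gaussMap K p)ᗮ.orthogonalProjectionOnto (G p) = 0 := by
    rw [Submodule.orthogonalProjectionOnto_eq_zero_iff, Submodule.orthogonal_orthogonal, hG_smul]
    exact Submodule.smul_mem _ _ (Submodule.mem_span_singleton_self _)
  -- A derivative within the boundary is determined only on the tangent cone, so the comparison is
  -- made there.
  have heq := hD.unique_on hW (hK.mem_tangentConeAt hp hv)
  simp only [LinearMap.comp_apply, Submodule.subtype_apply, ContinuousLinearMap.coe_coe,
    compressOrthogonal, LinearMap.smul_apply]
  rw [heq]
  simp [hz]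

/-- The centro-affine curvature is the Jacobian determinant of the duality map. -/
lemma centroAffineCurvature_eq (hK : IsSmoothBody K) {p : Space n} (hp : p ∈ frontier K) :
    centroAffineCurvature K p = (fderiv ℝ (dualityMap K) p).det := by
  have hp0 := hK.ne_zero hp
  have hG0 := hK.dualityMap_ne_zero hp0
  have hn : ‖dualityMap K p‖ ≠ 0 := norm_ne_zero_iff.2 hG0
  have hn1 : 1 ≤ n := by
    rcases Nat.eq_zero_or_pos n with rfl | h
    · exact absurd (Subsingleton.elim p 0) hp0
    · exact h
  have hν : ‖gaussMap K p‖ = 1 := by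
    rw [hK.gaussMap_eq hp, norm_smul, norm_inv, norm_norm, inv_mul_cancel₀ hn]
  have hB : (fderiv ℝ (dualityMap K) p : Space n →ₗ[ℝ] Space n) p =
      ‖dualityMap K p‖ • gaussMap K p := by
    rw [ContinuousLinearMap.coe_coe, hK.fderiv_dualityMap_self hp0, hK.gaussMap_eq hp, smul_smul,
      mul_inv_cancel₀ hn, one_smul]
  -- This yields det G'(p) = ‖G(p)‖² D, with D the determinant of the compression. As ⟨p, ν⟩ =
  -- ‖G(p)‖⁻¹, also κ₀ = ‖G(p)‖^(-(n-1)) D ‖G(p)‖^(n+1), the same number.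
  have h := inner_mul_det_eq hν hB
  rw [hK.inner_gaussMap hp, inv_mul_eq_iff_eq_mul₀ hn] at h
  rw [centroAffineCurvature, hK.inner_gaussMap hp, hK.gaussCurvature_eq hp,
    ContinuousLinearMap.det, h]
  obtain ⟨m, rfl⟩ : ∃ m, n = m + 1 := ⟨n - 1, by omega⟩
  simp only [Nat.add_sub_cancel]
  simp only [inv_pow]
  field_simp
  ring

end IsSmoothBody
end PolarFloating

/-! ### Strict convexity, bijectivity of the duality map, change of variables. -/

namespace PolarFloating

/-- Take square roots of the eigenvalues in an orthonormal eigenbasis. For B = G'(x), S makes the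
form definite once det B > 0, and later maps osculating ellipsoids to balls. -/
lemma exists_symmetric_sqrt {E : Type*} [NormedAddCommGroup E] [InnerProductSpace ℝ E]
    [FiniteDimensional ℝ E] {B : E →ₗ[ℝ] E} (hB : B.IsSymmetric) (hpos : ∀ v, 0 ≤ ⟪B v, v⟫) :
    ∃ S : E →ₗ[ℝ] E, (∀ v w, ⟪B v, w⟫ = ⟪S v, S w⟫) ∧
      LinearMap.det S ^ 2 = LinearMap.det B := by
  set b := hB.eigenvectorBasis rfl
  set l := hB.eigenvalues rfl
  have hBb : ∀ i, B (b i) = l i • b i := fun i => hB.apply_eigenvectorBasis rfl i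
  have hl : ∀ i, 0 ≤ l i := by
    intro i
    have := hpos (b i)
    rwa [hBb, real_inner_smul_left, real_inner_self_eq_norm_sq, b.orthonormal.1 i, one_pow,
      mul_one] at this
  set S : E →ₗ[ℝ] E := b.toBasis.constr ℝ fun i => √(l i) • b i with hS
  have hSb : ∀ i, S (b i) = √(l i) • b i := by
    intro i
    rw [hS, ← b.coe_toBasis, Module.Basis.constr_basis]
  have hadj : S = LinearMap.adjoint S := by
    rw [LinearMap.eq_adjoint_iff_basis b.toBasis b.toBasis]
    intro i j
    simp only [b.coe_toBasis, hSb, real_inner_smul_left, inner_smul_right,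
      orthonormal_iff_ite.1 b.orthonormal]
    split_ifs with h
    · rw [h]
    · simp
  have hSS : S ∘ₗ S = B := by
    refine b.toBasis.ext fun i => ?_
    simp only [b.coe_toBasis, LinearMap.comp_apply, hSb, map_smul, smul_smul,
      Real.mul_self_sqrt (hl i), hBb]
  refine ⟨S, fun v w => ?_, ?_⟩
  · rw [← hSS, LinearMap.comp_apply, ← LinearMap.adjoint_inner_right, ← hadj]
  · rw [sq, ← LinearMap.det_comp, hSS]

variable {n : ℕ} {K : Set (Space n)}

/-- The Jacobian determinant of the duality map; on the boundary it is the centro-affine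
curvature. -/
noncomputable def dualityJacobian (K : Set (Space n)) (x : Space n) : ℝ :=
  (fderiv ℝ (dualityMap K) x).det

/-- A body of class `C²₊`. -/
structure IsRegularBody (K : Set (Space n)) : Prop extends IsSmoothBody K where
  dualityJacobian_pos : ∀ x : Space n, x ≠ 0 → 0 < dualityJacobian K x

lemma IsSmoothBody.dualityJacobian_smul (hK : IsSmoothBody K) {x : Space n} (hx : x ≠ 0) {t : ℝ}
    (ht : 0 < t) : dualityJacobian K (t • x) = dualityJacobian K x := by
  rw [dualityJacobian, hK.fderiv_dualityMap_smul hx ht, dualityJacobian]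

lemma IsSmoothBody.isRegularBody (hK : IsSmoothBody K)
    (hpos : ∀ x ∈ frontier K, 0 < gaussCurvature K x) : IsRegularBody K := by
  refine ⟨hK, fun x hx => ?_⟩
  have hp := hK.radial_mem hx
  rw [← hK.dualityJacobian_smul hx (inv_pos.2 (hK.gauge_pos hx)), dualityJacobian,
    ← hK.centroAffineCurvature_eq hp, centroAffineCurvature, hK.inner_gaussMap hp]
  have : 0 < ‖dualityMap K ((gauge K x)⁻¹ • x)‖ :=
    norm_pos_iff.2 (hK.dualityMap_ne_zero (hK.ne_zero hp))
  exact div_pos (hpos _ hp) (by positivity)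

namespace IsRegularBody

lemma exists_sqrt (hK : IsRegularBody K) {x : Space n} (hx : x ≠ 0) :
    ∃ S : Space n →ₗ[ℝ] Space n,
      (∀ v w, ⟪fderiv ℝ (dualityMap K) x v, w⟫ = ⟪S v, S w⟫) ∧
      LinearMap.det S ^ 2 = dualityJacobian K x :=
  exists_symmetric_sqrt (B := (fderiv ℝ (dualityMap K) x : Space n →ₗ[ℝ] Space n))
    (fun v w => hK.inner_fderiv_dualityMap_comm hx v w)
    (fun v => hK.inner_fderiv_dualityMap_nonneg hx v)

lemma inner_fderiv_dualityMap_pos (hK : IsRegularBody K) {x : Space n} (hx : x ≠ 0)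
    {v : Space n} (hv : v ≠ 0) : 0 < ⟪fderiv ℝ (dualityMap K) x v, v⟫ := by
  obtain ⟨S, hS, hdet⟩ := hK.exists_sqrt hx
  have hdet0 : LinearMap.det S ≠ 0 := by
    intro h
    rw [h, zero_pow two_ne_zero] at hdet
    exact (hK.dualityJacobian_pos x hx).ne hdet
  rw [hS, real_inner_self_eq_norm_sq]
  have : S v ≠ 0 := by
    intro h
    have hinj : Function.Injective S :=
      (LinearMap.equivOfDetNeZero S hdet0).injective
    exact hv (hinj (by rw [h, map_zero]))
  positivity

/-- Strict convexity. -/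
lemma inner_dualityMap_lt_one (hK : IsRegularBody K) {x y : Space n} (hx : x ∈ frontier K)
    (hy : y ∈ K) (hne : y ≠ x) : ⟪dualityMap K x, y⟫ < 1 := by
  have hx0 := hK.ne_zero hx
  have hgx := hK.mem_frontier_iff.1 hx
  have hgy := hK.gauge_le_one_iff.2 hy
  have hle := hK.inner_dualityMap_le hx0 y
  rw [hgx, one_mul] at hle
  by_contra! hge
  have h1 : ⟪dualityMap K x, y⟫ = 1 := le_antisymm (hle.trans hgy) hge
  have hxx : ⟪dualityMap K x, x⟫ = 1 := by rw [hK.inner_dualityMap_self hx0, hgx, one_pow]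
  -- With equality, the segment from x to y lies in the supporting hyperplane, hence in ∂K.
  -- Definiteness of G'(x) gives ⟨G(z), y - x⟩ > 0 at a point z of the segment near x, so ⟨G(z), y⟩
  -- > 1, which is impossible for y ∈ K.
  have hz1 : ∀ s : ℝ, ⟪dualityMap K x, x + s • (y - x)⟫ = 1 := by
    intro s
    rw [inner_add_right, inner_smul_right, inner_sub_right, hxx, h1]
    ring
  have hd1 : HasDerivAt (fun t : ℝ => x + t • (y - x)) (y - x) 0 := by
    simpa using ((hasDerivAt_id (0 : ℝ)).smul_const (y - x)).const_add x
  have hd2 : HasFDerivAt (dualityMap K) (fderiv ℝ (dualityMap K) x) (x + (0 : ℝ) • (y - x)) := by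
    simpa using hK.hasFDerivAt_dualityMap hx0
  have hslope := ((hd2.comp_hasDerivAt (0 : ℝ) hd1).tendsto_slope_zero_right).inner (𝕜 := ℝ)
    (tendsto_const_nhds (x := y - x))
  have hpos := hK.inner_fderiv_dualityMap_pos hx0 (sub_ne_zero.2 hne)
  obtain ⟨s, hs, hs0, hs1⟩ := ((hslope.eventually (lt_mem_nhds hpos)).and
    (Ioo_mem_nhdsGT (zero_lt_one (α := ℝ)))).exists
  simp only [Function.comp_apply, zero_add, zero_smul, add_zero, real_inner_smul_left,
    inner_sub_left] at hs
  set z := x + s • (y - x) with hz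
  have hz0 : z ≠ 0 := by
    intro h
    have := hz1 s
    rw [← hz, h, inner_zero_right] at this
    exact zero_ne_one this
  have hgz : gauge K z = 1 := by
    refine le_antisymm (hK.gauge_le_one_iff.2 ?_) ?_
    · exact hK.convex.add_smul_sub_mem (hK.isCompact.isClosed.frontier_subset hx) hy ⟨hs0.le, hs1.le⟩
    · have := hK.inner_dualityMap_le hx0 z
      rwa [hgx, one_mul, hz1] at this
  have hzy := hK.inner_dualityMap_le hz0 y
  have hzz := hK.inner_dualityMap_self hz0
  have hyx : y = z + (1 - s) • (y - x) := by
    rw [hz]; module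
  have h0 : ⟪dualityMap K x, y - x⟫ = 0 := by rw [inner_sub_right, h1, hxx, sub_self]
  rw [h0, sub_zero] at hs
  have hs' : 0 < ⟪dualityMap K z, y - x⟫ := by
    have := (mul_pos_iff_of_pos_left (inv_pos.2 hs0)).1 hs
    exact this
  have h5 : ⟪dualityMap K z, y⟫ = 1 + (1 - s) * ⟪dualityMap K z, y - x⟫ := by
    nth_rewrite 1 [hyx]
    rw [inner_add_right, hzz, hgz, inner_smul_right]
    ring
  rw [hgz, one_mul] at hzy
  nlinarith [mul_pos (sub_pos.2 hs1) hs']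

/-- The support inequality applied both ways forces equal gauges; strict convexity then identifies
the radial projections. -/
lemma injOn_dualityMap (hK : IsRegularBody K) : Set.InjOn (dualityMap K) {0}ᶜ := by
  intro x hx y hy hxy
  have hx : x ≠ 0 := hx
  have hy : y ≠ 0 := hy
  have hgx := hK.gauge_pos hx
  have hgy := hK.gauge_pos hy
  have h1 := hK.inner_dualityMap_le hx y
  have h2 := hK.inner_dualityMap_le hy x
  rw [hxy, hK.inner_dualityMap_self hy] at h1
  rw [← hxy, hK.inner_dualityMap_self hx] at h2
  have hg : gauge K x = gauge K y := by
    apply le_antisymm <;> nlinarith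
  have hcast : (gauge K y)⁻¹ • y = (gauge K x)⁻¹ • x := by
    by_contra hne
    have := hK.inner_dualityMap_lt_one (hK.radial_mem hx)
      (hK.isCompact.isClosed.frontier_subset (hK.radial_mem hy)) hne
    rw [hK.dualityMap_smul hx (inv_pos.2 hgx), hxy, real_inner_smul_left, inner_smul_right,
      hK.inner_dualityMap_self hy, hg, sq] at this
    field_simp at this
    exact lt_irrefl _ this
  rw [hg] at hcast
  exact (smul_right_injective _ (inv_ne_zero hgy.ne') hcast).symm

/-- A maximiser of ⟨y, ·⟩ over K is a boundary point with normal direction y; homogeneity adjusts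
the length. -/
lemma exists_dualityMap_eq (hK : IsRegularBody K) {y : Space n} (hy : y ≠ 0) :
    ∃ x, x ≠ 0 ∧ dualityMap K x = y := by
  obtain ⟨p, hp, hmax⟩ := hK.isCompact.exists_isMaxOn
    ⟨0, interior_subset hK.zero_mem⟩ (innerSL ℝ y).continuous.continuousOn
  have hpf : p ∈ frontier K := by
    refine ⟨subset_closure hp, fun hint => ?_⟩
    have := (hmax.isLocalMax (mem_interior_iff_mem_nhds.1 hint)).hasFDerivAt_eq_zero
      (innerSL ℝ y).hasFDerivAt
    exact hy (inner_self_eq_zero.1 (congrArg (fun f : Space n →L[ℝ] ℝ => f y) this))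
  have hny : 0 < ‖y‖ := norm_pos_iff.2 hy
  have hn : IsOuterUnitNormal K p (‖y‖⁻¹ • y) := by
    refine ⟨by rw [norm_smul, norm_inv, norm_norm, inv_mul_cancel₀ hny.ne'], fun z hz => ?_⟩
    rw [inner_smul_right, inner_smul_right, real_inner_comm, real_inner_comm y p]
    exact mul_le_mul_of_nonneg_left (hmax hz) (inv_nonneg.2 hny.le)
  have hp0 := hK.ne_zero hpf
  have hG : 0 < ‖dualityMap K p‖ := norm_pos_iff.2 (hK.dualityMap_ne_zero hp0)
  have heq := (hK.isOuterUnitNormal_iff hpf).1 hn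
  have hc : 0 < ‖y‖ * ‖dualityMap K p‖⁻¹ := by positivity
  refine ⟨(‖y‖ * ‖dualityMap K p‖⁻¹) • p, smul_ne_zero hc.ne' hp0, ?_⟩
  rw [hK.dualityMap_smul hp0 hc, mul_smul, ← heq, smul_smul, mul_inv_cancel₀ hny.ne', one_smul]

lemma dualityMap_mem_polarBody_iff (hK : IsRegularBody K) {x : Space n} (hx : x ≠ 0) :
    dualityMap K x ∈ polarBody K ↔ gauge K x ≤ 1 := by
  have hg := hK.gauge_pos hx
  constructor
  · intro h
    have := h _ (hK.isCompact.isClosed.frontier_subset (hK.radial_mem hx))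
    rw [real_inner_smul_left, real_inner_comm, hK.inner_dualityMap_self hx, sq,
      inv_mul_cancel_left₀ hg.ne'] at this
    exact this
  · intro h y hy
    rw [real_inner_comm]
    have h1 := hK.inner_dualityMap_le hx y
    have h2 := hK.gauge_le_one_iff.2 hy
    have h3 : 0 ≤ gauge K y := gauge_nonneg y
    nlinarith

/-- Strict convexity leaves only one candidate for the choice made in `boundaryPoint`. -/
lemma boundaryPoint_eq (hK : IsRegularBody K) {x : Space n} (hx : x ∈ frontier K) :
    boundaryPoint K (‖dualityMap K x‖⁻¹ • dualityMap K x) = x := by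
  have hx0 := hK.ne_zero hx
  have hxK := hK.isCompact.isClosed.frontier_subset hx
  obtain ⟨hz, hzn⟩ : boundaryPoint K (‖dualityMap K x‖⁻¹ • dualityMap K x) ∈ K ∧
      IsOuterUnitNormal K (boundaryPoint K (‖dualityMap K x‖⁻¹ • dualityMap K x))
        (‖dualityMap K x‖⁻¹ • dualityMap K x) :=
    Classical.epsilon_spec (p := fun z => z ∈ K ∧
      IsOuterUnitNormal K z (‖dualityMap K x‖⁻¹ • dualityMap K x))
      ⟨x, hxK, (hK.isOuterUnitNormal_iff hx).2 rfl⟩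
  by_contra hne
  have h1 := hK.inner_dualityMap_lt_one hx hz hne
  have h2 := hzn.2 x hxK
  have hG : 0 < ‖dualityMap K x‖ := norm_pos_iff.2 (hK.dualityMap_ne_zero hx0)
  rw [inner_smul_right, inner_smul_right, mul_le_mul_iff_right₀ (inv_pos.2 hG),
    real_inner_comm, hK.inner_dualityMap_self hx0, hK.mem_frontier_iff.1 hx,
    real_inner_comm] at h2
  linarith

lemma measurable_dualityMap (hK : IsRegularBody K) : Measurable (dualityMap K) :=
  measurable_of_continuousOn_compl_singleton 0 fun _ hx =>
    (hK.contDiffAt_dualityMap hx).continuousAt.continuousWithinAt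

lemma continuousAt_dualityJacobian (hK : IsRegularBody K) {x : Space n} (hx : x ≠ 0) :
    ContinuousAt (dualityJacobian K) x :=
  ContinuousLinearMap.continuous_det.continuousAt.comp (hK.continuousAt_fderiv_dualityMap hx)

lemma measurable_dualityJacobian (hK : IsRegularBody K) : Measurable (dualityJacobian K) :=
  measurable_of_continuousOn_compl_singleton 0 fun _ hx =>
    (hK.continuousAt_dualityJacobian hx).continuousWithinAt

variable [NeZero n]

/-- Volume in the coordinates given by the duality map. -/
lemma volume_eq_setLIntegral (hK : IsRegularBody K) {A : Set (Space n)} (hA : MeasurableSet A) :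
    volume A = ∫⁻ x in dualityMap K ⁻¹' A, ENNReal.ofReal (dualityJacobian K x) := by
  have hs : MeasurableSet (dualityMap K ⁻¹' A ∩ {0}ᶜ) :=
    (hK.measurable_dualityMap hA).inter (measurableSet_singleton 0).compl
  have himg : dualityMap K '' (dualityMap K ⁻¹' A ∩ {0}ᶜ) = A \ {0} := by
    ext y
    constructor
    · rintro ⟨x, ⟨hxA, hx0⟩, rfl⟩
      exact ⟨hxA, hK.dualityMap_ne_zero hx0⟩
    · rintro ⟨hyA, hy0⟩
      obtain ⟨x, hx0, rfl⟩ := hK.exists_dualityMap_eq hy0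
      exact ⟨x, ⟨hyA, hx0⟩, rfl⟩
  have h := lintegral_image_eq_lintegral_abs_det_fderiv_mul volume hs
    (fun x hx => (hK.hasFDerivAt_dualityMap hx.2).hasFDerivWithinAt)
    (hK.injOn_dualityMap.mono Set.inter_subset_right) (fun _ => 1)
  simp only [himg, mul_one, setLIntegral_one] at h
  rw [measure_sdiff_null (measure_singleton 0)] at h
  have hae : (dualityMap K ⁻¹' A ∩ {0}ᶜ : Set (Space n)) =ᵐ[volume] dualityMap K ⁻¹' A :=
    sdiff_null_ae_eq_self (measure_singleton (0 : Space n))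
  rw [h, ← setLIntegral_congr hae]
  refine setLIntegral_congr_fun hs fun x hx => ?_
  rw [← dualityJacobian, abs_of_pos (hK.dualityJacobian_pos x hx.2)]

lemma affineSurfaceArea_eq (hK : IsRegularBody K) {φ : ℝ → ℝ}
    (hmeas : AEMeasurable (fun x => φ (centroAffineCurvature K x)) (coneMeasure K)) :
    affineSurfaceArea φ K = n * ∫⁻ x in K, ENNReal.ofReal (φ (dualityJacobian K x)) := by
  have hn : (n : ℝ≥0∞) ≠ 0 := by simpa using NeZero.ne n
  have hr : Measurable fun x => (gauge K x)⁻¹ • x :=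
    hK.continuous_gauge.measurable.inv.smul measurable_id
  rw [affineSurfaceArea, coneMeasure, lintegral_smul_measure, smul_eq_mul]
  rw [lintegral_map' _ hr.aemeasurable]
  · congr 1
    refine lintegral_congr_ae (ae_restrict_of_ae ?_)
    filter_upwards [Measure.ae_ne volume (0 : Space n)] with x hx
    rw [hK.centroAffineCurvature_eq (hK.radial_mem hx), ← dualityJacobian,
      hK.dualityJacobian_smul hx (inv_pos.2 (hK.gauge_pos hx))]
  -- The cone measure is n times a pushforward; as n ≠ 0, almost everywhere measurability passes to
  -- the pushforward itself.
  · refine (hmeas.mono_ac ?_).ennreal_ofReal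
    rw [coneMeasure]
    exact Measure.AbsolutelyContinuous.smul_right Measure.AbsolutelyContinuous.rfl hn

end IsRegularBody
end PolarFloating

/-! ### Volume of caps of the Euclidean ball. -/

namespace PolarFloating

lemma measurePreserving_split (m : ℕ) :
    MeasurePreserving (fun z : Space (m + 1) =>
      (z 0, (WithLp.toLp 2 fun i : Fin m => z i.succ : Space m))) := by
  have h1 := PiLp.volume_preserving_ofLp (Fin (m + 1))
  have h2 := volume_preserving_piFinSuccAbove (fun _ : Fin (m + 1) => ℝ) 0
  have h3 := (MeasurePreserving.id (volume : Measure ℝ)).prod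
    (PiLp.volume_preserving_toLp (Fin m))
  exact h3.comp (h2.comp h1)

lemma exists_isometry_apply_zero {m : ℕ} {e : Space (m + 1)} (he : ‖e‖ = 1) :
    ∃ f : Space (m + 1) ≃ₗᵢ[ℝ] Space (m + 1), ∀ y, (f y) 0 = ⟪e, y⟫ := by
  have hv : Orthonormal ℝ (Set.domRestrict ({0} : Set (Fin (m + 1))) fun _ => e) := by
    exact ⟨fun _ => he, fun i j hij => absurd (Subsingleton.elim i j) hij⟩
  obtain ⟨b, hb⟩ := hv.exists_orthonormalBasis_extension_of_card_eq (by simp)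
  refine ⟨b.repr, fun y => ?_⟩
  rw [b.repr_apply_apply, hb 0 rfl]

/-- Rotate e to the first coordinate vector and use Fubini; the slice at height s is a ball of
radius √(1 - s²). -/
lemma volume_ball_cap_eq {m : ℕ} {e : Space (m + 1)} (he : ‖e‖ = 1) {τ : ℝ} (hτ1 : τ ≤ 1) :
    volume {y : Space (m + 1) | ‖y‖ ≤ 1 ∧ 1 - τ ≤ ⟪e, y⟫} =
      volume (Metric.ball (0 : Space m) 1) *
        ∫⁻ s in Set.Icc (1 - τ) 1, ENNReal.ofReal (√(1 - s ^ 2) ^ m) := by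
  obtain ⟨f, hf⟩ := exists_isometry_apply_zero he
  have hD : MeasurableSet {q : ℝ × Space m | q.1 ^ 2 + ‖q.2‖ ^ 2 ≤ 1 ∧ 1 - τ ≤ q.1} := by
    measurability
  have hmp := (measurePreserving_split m).comp f.measurePreserving
  have hpre : {y : Space (m + 1) | ‖y‖ ≤ 1 ∧ 1 - τ ≤ ⟪e, y⟫} =
      (fun y => ((f y) 0, (WithLp.toLp 2 fun i : Fin m => (f y) i.succ : Space m))) ⁻¹'
        {q : ℝ × Space m | q.1 ^ 2 + ‖q.2‖ ^ 2 ≤ 1 ∧ 1 - τ ≤ q.1} := by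
    ext y
    have h1 : ‖y‖ ≤ 1 ↔ ‖f y‖ ^ 2 ≤ 1 := by
      rw [f.norm_map, sq_le_one_iff₀ (norm_nonneg _)]
    simp only [Set.mem_ofPred_eq, Set.mem_preimage, h1, hf, EuclideanSpace.norm_sq_eq,
      Fin.sum_univ_succ, Real.norm_eq_abs, sq_abs]
  rw [hpre]
  erw [hmp.measure_preimage hD.nullMeasurableSet]
  rw [Measure.volume_eq_prod, Measure.prod_apply hD, ← lintegral_const_mul' _ _ (by
    exact measure_ball_lt_top.ne), ← lintegral_indicator measurableSet_Icc]
  refine lintegral_congr fun s => ?_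
  by_cases hs : s ∈ Set.Icc (1 - τ) 1
  · rw [Set.indicator_of_mem hs]
    have h0 : 0 ≤ 1 - s ^ 2 := by nlinarith [hs.1, hs.2]
    have : Prod.mk s ⁻¹' {q : ℝ × Space m | q.1 ^ 2 + ‖q.2‖ ^ 2 ≤ 1 ∧ 1 - τ ≤ q.1} =
        Metric.closedBall 0 √(1 - s ^ 2) := by
      ext w
      simp only [Set.mem_preimage, Set.mem_ofPred_eq, hs.1, and_true, Metric.mem_closedBall,
        dist_zero_right]
      rw [Real.le_sqrt (norm_nonneg _) h0]
      constructor <;> intro h <;> linarith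
    rw [this, Measure.addHaar_closedBall _ _ (Real.sqrt_nonneg _), finrank_euclideanSpace_fin,
      mul_comm]
  · rw [Set.indicator_of_notMem hs]
    have : Prod.mk s ⁻¹' {q : ℝ × Space m | q.1 ^ 2 + ‖q.2‖ ^ 2 ≤ 1 ∧ 1 - τ ≤ q.1} = ∅ := by
      ext w
      simp only [Set.mem_preimage, Set.mem_ofPred_eq, Set.mem_empty_iff_false, iff_false, not_and]
      intro h1 h2
      refine hs ⟨h2, ?_⟩
      nlinarith [sq_nonneg ‖w‖]
    rw [this, measure_empty]

lemma volume_real_ball_cap_eq {m : ℕ} {e : Space (m + 1)} (he : ‖e‖ = 1) {τ : ℝ} (hτ : 0 < τ)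
    (hτ1 : τ ≤ 1) :
    volume.real {y : Space (m + 1) | ‖y‖ ≤ 1 ∧ 1 - τ ≤ ⟪e, y⟫} =
      volume.real (Metric.ball (0 : Space m) 1) * ∫ s in (1 - τ)..1, √(1 - s ^ 2) ^ m := by
  rw [measureReal_def, volume_ball_cap_eq he hτ1, ENNReal.toReal_mul, ← measureReal_def,
    intervalIntegral.integral_of_le (by linarith), ← integral_Icc_eq_integral_Ioc,
    integral_eq_lintegral_of_nonneg_ae]
  · exact Eventually.of_forall fun s => by positivity
  · exact (by fun_prop : Continuous fun s : ℝ => √(1 - s ^ 2) ^ m).aestronglyMeasurable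

lemma integral_one_sub_rpow (m : ℕ) {τ : ℝ} :
    ∫ s in (1 - τ)..1, (1 - s) ^ ((m : ℝ) / 2) = τ ^ ((m : ℝ) / 2 + 1) / ((m : ℝ) / 2 + 1) := by
  rw [intervalIntegral.integral_comp_sub_left (fun s => s ^ ((m : ℝ) / 2)), sub_self,
    sub_sub_cancel, integral_rpow (Or.inl (by have : (0 : ℝ) ≤ m := m.cast_nonneg; linarith)),
    Real.zero_rpow (by positivity), sub_zero]

/-- Factor 1 - s² = (1 + s)(1 - s) with 2 - τ ≤ 1 + s ≤ 2 on the range of integration; the power of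
1 - s integrates exactly. -/
lemma ball_cap_bounds {n : ℕ} [NeZero n] {e : Space n} (he : ‖e‖ = 1) {τ : ℝ} (hτ : 0 < τ)
    (hτ1 : τ ≤ 1) :
    volume.real (Metric.ball (0 : Space (n - 1)) 1) / (n + 1) * (2 * τ) ^ (((n : ℝ) + 1) / 2) *
        (1 - τ / 2) ^ (((n : ℝ) - 1) / 2) ≤
      volume.real {y : Space n | ‖y‖ ≤ 1 ∧ 1 - τ ≤ ⟪e, y⟫} ∧
    volume.real {y : Space n | ‖y‖ ≤ 1 ∧ 1 - τ ≤ ⟪e, y⟫} ≤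
      volume.real (Metric.ball (0 : Space (n - 1)) 1) / (n + 1) *
        (2 * τ) ^ (((n : ℝ) + 1) / 2) := by
  obtain ⟨m, rfl⟩ : ∃ m, n = m + 1 := ⟨n - 1, by have := NeZero.pos n; omega⟩
  rw [volume_real_ball_cap_eq he hτ hτ1]
  change volume.real (Metric.ball (0 : Space m) 1) / _ * _ * _ ≤ _ ∧
    _ ≤ volume.real (Metric.ball (0 : Space m) 1) / _ * _
  set ω := volume.real (Metric.ball (0 : Space m) 1)
  have hω : 0 ≤ ω := measureReal_nonneg
  have hm : (0 : ℝ) ≤ m / 2 := by positivity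
  have hle : 1 - τ ≤ 1 := by linarith
  have hfac : ∀ s ∈ Set.Icc (1 - τ) 1,
      √(1 - s ^ 2) ^ m = (1 + s) ^ ((m : ℝ) / 2) * (1 - s) ^ ((m : ℝ) / 2) := by
    intro s hs
    have h1 : 0 ≤ 1 - s := by linarith [hs.2]
    have h2 : 0 ≤ 1 + s := by linarith [hs.1]
    rw [← Real.mul_rpow h2 h1, Real.sqrt_eq_rpow, ← Real.rpow_natCast, ← Real.rpow_mul (by nlinarith)]
    congr 1 <;> ring
  have hint : IntervalIntegrable (fun s : ℝ => √(1 - s ^ 2) ^ m) volume (1 - τ) 1 :=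
    (by fun_prop : Continuous fun s : ℝ => √(1 - s ^ 2) ^ m).intervalIntegrable _ _
  have hint2 : IntervalIntegrable (fun s : ℝ => (1 - s) ^ ((m : ℝ) / 2)) volume (1 - τ) 1 :=
    (Continuous.rpow_const (by fun_prop) fun s => Or.inr hm).intervalIntegrable _ _
  have hlow : (2 - τ) ^ ((m : ℝ) / 2) * (τ ^ ((m : ℝ) / 2 + 1) / ((m : ℝ) / 2 + 1)) ≤
      ∫ s in (1 - τ)..1, √(1 - s ^ 2) ^ m := by
    rw [← integral_one_sub_rpow, ← intervalIntegral.integral_const_mul]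
    refine intervalIntegral.integral_mono_on hle (hint2.const_mul _) hint fun s hs => ?_
    rw [hfac s hs]
    refine mul_le_mul_of_nonneg_right ?_ (Real.rpow_nonneg (by linarith [hs.2]) _)
    exact Real.rpow_le_rpow (by linarith) (by linarith [hs.1]) hm
  have hup : ∫ s in (1 - τ)..1, √(1 - s ^ 2) ^ m ≤
      2 ^ ((m : ℝ) / 2) * (τ ^ ((m : ℝ) / 2 + 1) / ((m : ℝ) / 2 + 1)) := by
    rw [← integral_one_sub_rpow, ← intervalIntegral.integral_const_mul]
    refine intervalIntegral.integral_mono_on hle hint (hint2.const_mul _) fun s hs => ?_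
    rw [hfac s hs]
    refine mul_le_mul_of_nonneg_right ?_ (Real.rpow_nonneg (by linarith [hs.2]) _)
    exact Real.rpow_le_rpow (by linarith [hs.1]) (by linarith [hs.2]) hm
  have key : ω / (((m + 1 : ℕ) : ℝ) + 1) * (2 * τ) ^ ((((m + 1 : ℕ) : ℝ) + 1) / 2) =
      ω * (2 ^ ((m : ℝ) / 2) * (τ ^ ((m : ℝ) / 2 + 1) / ((m : ℝ) / 2 + 1))) := by
    have h1 : (((m + 1 : ℕ) : ℝ) + 1) / 2 = (m : ℝ) / 2 + 1 := by push_cast; ring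
    have h2 : (2 : ℝ) ^ ((m : ℝ) / 2 + 1) = 2 ^ ((m : ℝ) / 2) * 2 := Real.rpow_add_one two_ne_zero _
    rw [h1, Real.mul_rpow zero_le_two hτ.le, h2]
    have h3 : (m : ℝ) / 2 + 1 = (((m + 1 : ℕ) : ℝ) + 1) / 2 := h1.symm
    rw [h3]
    field_simp
  have hexp : (((m + 1 : ℕ) : ℝ) - 1) / 2 = (m : ℝ) / 2 := by push_cast; ring
  constructor
  · rw [key, hexp, mul_assoc]
    refine mul_le_mul_of_nonneg_left (le_trans (le_of_eq ?_) hlow) hω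
    have : (2 - τ) = 2 * (1 - τ / 2) := by ring
    rw [this, Real.mul_rpow zero_le_two (by linarith)]
    ring
  · rw [key]
    exact mul_le_mul_of_nonneg_left hup hω

end PolarFloating

/-! ### Osculating ellipsoids, uniformly along the boundary. -/

namespace PolarFloating

variable {n : ℕ} {K : Set (Space n)}

lemma IsBody.exists_le_norm (hK : IsBody K) : ∃ r > 0, ∀ x ∈ frontier K, r ≤ ‖x‖ := by
  obtain ⟨r, hr, hsub⟩ := Metric.mem_nhds_iff.1 (isOpen_interior.mem_nhds hK.zero_mem)
  refine ⟨r, hr, fun x hx => ?_⟩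
  by_contra! hlt
  exact hx.2 (hsub (by simpa using hlt))

/-- The uniformity in x comes from continuity of G' at every point of the compact boundary. The mean
value inequality is used twice, first for G and then for g²/2 along a segment. -/
lemma IsSmoothBody.exists_taylor (hK : IsSmoothBody K) {ε : ℝ} (hε : 0 < ε) :
    ∃ η > 0, ∀ x ∈ frontier K, ∀ z : Space n, ‖z‖ < η →
      |gauge K (x + z) ^ 2 / 2 - 1 / 2 - ⟪dualityMap K x, z⟫ -
        ⟪fderiv ℝ (dualityMap K) x z, z⟫ / 2| ≤ ε * ‖z‖ ^ 2 := by
  obtain ⟨r, hr, hrx⟩ := hK.exists_le_norm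
  have hu := hK.isCompact_frontier.uniformContinuousAt_of_continuousAt (fderiv ℝ (dualityMap K))
    (fun x hx => hK.continuousAt_fderiv_dualityMap (hK.ne_zero hx)) (Metric.dist_mem_uniformity hε)
  obtain ⟨η, hη, hηu⟩ := Metric.mem_uniformity_dist.1 hu
  -- The radius r keeps the ball around x away from the origin, where G may fail to be
  -- differentiable.
  refine ⟨min η r, lt_min hη hr, fun x hx z hz => ?_⟩
  set B := fderiv ℝ (dualityMap K) x
  have hball : ∀ y ∈ Metric.ball x (min η r), y ≠ 0 := by
    rintro y hy rfl
    rw [Metric.mem_ball, dist_zero_left] at hy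
    exact absurd (hrx x hx) (not_le.2 (hy.trans_le (min_le_right _ _)))
  have hG : ∀ y ∈ Metric.ball x (min η r),
      ‖dualityMap K y - dualityMap K x - B (y - x)‖ ≤ ε * ‖y - x‖ := by
    intro y hy
    refine (convex_ball x (min η r)).norm_image_sub_le_of_norm_hasFDerivWithin_le'
      (fun w hw => (hK.hasFDerivAt_dualityMap (hball w hw)).hasFDerivWithinAt) (fun w hw => ?_)
      (Metric.mem_ball_self (lt_min hη hr)) hy
    have := hηu (a := x) (b := w)
      (by rw [dist_comm]; exact (Metric.mem_ball.1 hw).trans_le (min_le_left _ _)) hx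
    rw [Set.mem_ofPred_eq, dist_comm, dist_eq_norm] at this
    exact this.le
  have hmem : ∀ t ∈ Set.Icc (0 : ℝ) 1, x + t • z ∈ Metric.ball x (min η r) := by
    intro t ht
    rw [Metric.mem_ball, dist_eq_norm, add_sub_cancel_left, norm_smul, Real.norm_of_nonneg ht.1]
    exact (mul_le_of_le_one_left (norm_nonneg z) ht.2).trans_lt hz
  have hderiv : ∀ t ∈ Set.Icc (0 : ℝ) 1,
      HasDerivWithinAt (fun t : ℝ => gauge K (x + t • z) ^ 2 / 2 - t * ⟪dualityMap K x, z⟫ -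
        t ^ 2 * (⟪B z, z⟫ / 2))
        (⟪dualityMap K (x + t • z) - dualityMap K x - B (t • z), z⟫) (Set.Icc 0 1) t := by
    intro t ht
    have h1 : HasDerivAt (fun t : ℝ => x + t • z) z t := by
      simpa using ((hasDerivAt_id t).smul_const z).const_add x
    have h2 := (hK.hasFDerivAt_half_sq (hball _ (hmem t ht))).comp_hasDerivAt t h1
    have h3 := (hasDerivAt_id t).mul_const ⟪dualityMap K x, z⟫
    have h4 := (hasDerivAt_pow 2 t).mul_const (⟪B z, z⟫ / 2)
    refine (((h2.sub h3).sub h4).congr_deriv ?_).hasDerivWithinAt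
    rw [inner_sub_left, inner_sub_left, map_smul, real_inner_smul_left, innerSL_apply_apply]
    push_cast
    ring
  have hbound : ∀ t ∈ Set.Ico (0 : ℝ) 1,
      ‖⟪dualityMap K (x + t • z) - dualityMap K x - B (t • z), z⟫‖ ≤ ε * ‖z‖ ^ 2 := by
    intro t ht
    have h1 := hG _ (hmem t ⟨ht.1, ht.2.le⟩)
    rw [add_sub_cancel_left] at h1
    refine (norm_inner_le_norm _ _).trans ?_
    have h2 : ‖t • z‖ ≤ ‖z‖ := by
      rw [norm_smul, Real.norm_of_nonneg ht.1]
      exact mul_le_of_le_one_left (norm_nonneg z) ht.2.le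
    calc _ ≤ (ε * ‖t • z‖) * ‖z‖ := by gcongr
      _ ≤ (ε * ‖z‖) * ‖z‖ := by gcongr
      _ = _ := by ring
  have h := norm_image_sub_le_of_norm_deriv_le_segment_01' hderiv hbound
  rw [Real.norm_eq_abs] at h
  refine le_trans (le_of_eq ?_) h
  congr 1
  simp only [one_smul, zero_smul, add_zero, hK.mem_frontier_iff.1 hx]
  ring

namespace IsRegularBody

lemma exists_elliptic (hK : IsRegularBody K) :
    ∃ l > 0, ∀ x ∈ frontier K, ∀ z : Space n,
      l * ‖z‖ ^ 2 ≤ ⟪fderiv ℝ (dualityMap K) x z, z⟫ := by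
  have hc : ContinuousOn (fun q : Space n × Space n => ⟪fderiv ℝ (dualityMap K) q.1 q.2, q.2⟫)
      (frontier K ×ˢ Metric.sphere 0 1) := by
    rintro ⟨x, z⟩ ⟨hx, hz⟩
    have h1 : ContinuousAt (fun q : Space n × Space n => fderiv ℝ (dualityMap K) q.1) (x, z) :=
      (hK.continuousAt_fderiv_dualityMap (hK.ne_zero hx)).comp (x := (x, z)) continuousAt_fst
    exact ((h1.clm_apply continuousAt_snd).inner continuousAt_snd).continuousWithinAt
  obtain ⟨l, hl, hle⟩ := (hK.isCompact_frontier.prod (isCompact_sphere 0 1)).exists_forall_le'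
    hc (a := 0) (by
      rintro ⟨x, z⟩ ⟨hx, hz⟩
      exact hK.inner_fderiv_dualityMap_pos (hK.ne_zero hx) (ne_zero_of_mem_unit_sphere ⟨z, hz⟩))
  refine ⟨l, hl, fun x hx z => ?_⟩
  rcases eq_or_ne z 0 with rfl | hz
  · simp
  · have hn : 0 < ‖z‖ := norm_pos_iff.2 hz
    have := hle (x, ‖z‖⁻¹ • z) ⟨hx, by simp [norm_smul, hn.ne']⟩
    simp only [map_smul, real_inner_smul_left, inner_smul_right] at this
    rw [← mul_assoc, ← sq, inv_pow, le_inv_mul_iff₀ (by positivity)] at this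
    linarith

/-- Strict convexity made uniform by compactness: shallow caps are small neighbourhoods of their
touching points. -/
lemma exists_inner_le_one_sub (hK : IsRegularBody K) {η : ℝ} (hη : 0 < η) :
    ∃ c > 0, ∀ x ∈ frontier K, ∀ y ∈ K, η ≤ ‖y - x‖ → ⟪dualityMap K x, y⟫ ≤ 1 - c := by
  have hcomp : IsCompact ((frontier K ×ˢ K) ∩ {q : Space n × Space n | η ≤ ‖q.2 - q.1‖}) :=
    (hK.isCompact_frontier.prod hK.isCompact).inter_right
      (isClosed_le continuous_const (by fun_prop))
  obtain ⟨c, hc, hle⟩ := hcomp.exists_forall_le' (a := 0)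
    (f := fun q : Space n × Space n => 1 - ⟪dualityMap K q.1, q.2⟫) (by
      rintro ⟨x, y⟩ ⟨⟨hx, hy⟩, -⟩
      have h1 : ContinuousAt (fun q : Space n × Space n => dualityMap K q.1) (x, y) :=
        (hK.contDiffAt_dualityMap (hK.ne_zero hx)).continuousAt.comp (x := (x, y)) continuousAt_fst
      exact (continuousAt_const.sub (h1.inner continuousAt_snd)).continuousWithinAt) (by
      rintro ⟨x, y⟩ ⟨⟨hx, hy⟩, hxy⟩
      refine sub_pos.2 (hK.inner_dualityMap_lt_one hx hy ?_)
      intro h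
      have h : y = x := h
      subst h
      simp only [Set.mem_ofPred_eq, sub_self, norm_zero] at hxy
      linarith)
  exact ⟨c, hc, fun x hx y hy hxy => by linarith [hle (x, y) ⟨⟨hx, hy⟩, hxy⟩]⟩

end IsRegularBody

/-- The cap of the osculating ellipsoid of `K` at `x`, dilated from `x` by `c⁻¹`. -/
def ellipsoidCap (K : Set (Space n)) (x : Space n) (c τ : ℝ) : Set (Space n) :=
  {y | ⟪dualityMap K x, y - x⟫ + c / 2 * ⟪fderiv ℝ (dualityMap K) x (y - x), y - x⟫ ≤ 0 ∧
    1 - τ ≤ ⟪dualityMap K x, y⟫}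

lemma IsRegularBody.volume_ellipsoidCap (hK : IsRegularBody K) {x : Space n} (hx : x ∈ frontier K)
    {c τ : ℝ} (hc : 0 < c) : ∃ e : Space n, ‖e‖ = 1 ∧
      volume.real (ellipsoidCap K x c τ) = (c ^ n)⁻¹ * (√(dualityJacobian K x))⁻¹ *
        volume.real {y : Space n | ‖y‖ ≤ 1 ∧ 1 - c * τ ≤ ⟪e, y⟫} := by
  have hx0 := hK.ne_zero hx
  have hJ := hK.dualityJacobian_pos x hx0
  obtain ⟨S, hS, hdet⟩ := hK.exists_sqrt hx0
  have hxx : ⟪dualityMap K x, x⟫ = 1 := by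
    rw [hK.inner_dualityMap_self hx0, hK.mem_frontier_iff.1 hx, one_pow]
  have hSx : ∀ v, ⟪S x, S v⟫ = ⟪dualityMap K x, v⟫ := fun v => by
    rw [← hS, hK.fderiv_dualityMap_self hx0]
  have hSx1 : ‖S x‖ ^ 2 = 1 := by rw [← real_inner_self_eq_norm_sq, hSx, hxx]
  have habs : |LinearMap.det S| = √(dualityJacobian K x) := by rw [← hdet, Real.sqrt_sq_eq_abs]
  have hd0 : LinearMap.det (c • S) ≠ 0 := by
    rw [LinearMap.det_smul]
    refine mul_ne_zero (pow_ne_zero _ hc.ne') fun h => ?_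
    rw [h, zero_pow two_ne_zero] at hdet
    exact hJ.ne hdet
  -- S x is a unit vector since ⟨G'(x)x, x⟩ = ⟨G(x), x⟩ = 1. The affine map y ↦ c S y + (1 - c) S x,
  -- which fixes the image S x of the touching point, carries the ellipsoid to the unit ball and
  -- height τ to height c τ.
  refine ⟨S x, by nlinarith [norm_nonneg (S x)], ?_⟩
  have hpre : ellipsoidCap K x c τ = (c • S) ⁻¹' ((fun y => y + (1 - c) • S x) ⁻¹'
      {y : Space n | ‖y‖ ≤ 1 ∧ 1 - c * τ ≤ ⟪S x, y⟫}) := by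
    ext y
    obtain ⟨z, rfl⟩ : ∃ z, y = x + z := ⟨y - x, by abel⟩
    have h1 : (c • S) (x + z) + (1 - c) • S x = S x + c • S z := by
      rw [LinearMap.smul_apply, map_add]; module
    simp only [ellipsoidCap, Set.mem_ofPred_eq, Set.mem_preimage, h1, add_sub_cancel_left]
    have h2 : ‖S x + c • S z‖ ^ 2 = 1 + 2 * c * (⟪dualityMap K x, z⟫ +
        c / 2 * ⟪fderiv ℝ (dualityMap K) x z, z⟫) := by
      rw [norm_add_sq_real, hSx1, inner_smul_right, hSx, norm_smul, mul_pow, hS,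
        real_inner_self_eq_norm_sq, Real.norm_eq_abs, sq_abs]
      ring
    have h3 : ⟪S x, S x + c • S z⟫ = 1 + c * ⟪dualityMap K x, z⟫ := by
      rw [inner_add_right, real_inner_self_eq_norm_sq, hSx1, inner_smul_right, hSx]
    rw [h3, ← sq_le_one_iff₀ (norm_nonneg _), h2, inner_add_right, hxx]
    refine and_congr ?_ ?_
    · constructor <;> intro h
      · nlinarith
      · by_contra! hlt
        nlinarith [mul_pos hc hlt]
    · constructor <;> intro h
      · nlinarith
      · by_contra! hlt
        nlinarith
  rw [hpre, measureReal_def, Measure.addHaar_preimage_linearMap _ hd0, measure_preimage_add_right,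
    ENNReal.toReal_mul, ENNReal.toReal_ofReal (abs_nonneg _), ← measureReal_def, abs_inv,
    LinearMap.det_smul, abs_mul, habs, abs_of_pos (pow_pos hc _), finrank_euclideanSpace_fin,
    mul_inv]

lemma IsRegularBody.exists_ellipsoidCap_subset (hK : IsRegularBody K) {ε : ℝ} (hε : 0 < ε) :
    ∃ τ₀ > 0, ∀ x ∈ frontier K, ∀ τ < τ₀,
      ellipsoidCap K x (1 + ε) τ ⊆ {y | y ∈ K ∧ 1 - τ ≤ ⟪dualityMap K x, y⟫} ∧
      {y | y ∈ K ∧ 1 - τ ≤ ⟪dualityMap K x, y⟫} ⊆ ellipsoidCap K x (1 - ε) τ := by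
  obtain ⟨l, hl, hell⟩ := hK.exists_elliptic
  obtain ⟨η, hη, htay⟩ := hK.exists_taylor (ε := ε * l / 2) (by positivity)
  obtain ⟨c, hc, hsep⟩ := hK.exists_inner_le_one_sub hη
  -- Both bounds confine the caps to ‖y - x‖ < η, where Taylor applies. The bound c does this for
  -- points of K. In the ellipsoid, l‖y - x‖² is at most the quadratic form, which is at most 2τ < l
  -- η².
  refine ⟨min c (l * η ^ 2 / 2), by positivity, fun x hx τ hτ => ?_⟩
  have hx0 := hK.ne_zero hx
  have hxx : ⟪dualityMap K x, x⟫ = 1 := by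
    rw [hK.inner_dualityMap_self hx0, hK.mem_frontier_iff.1 hx, one_pow]
  have hτc := hτ.trans_le (min_le_left _ _)
  have hτl := hτ.trans_le (min_le_right _ _)
  have hnear : ∀ z, ‖z‖ < η → |gauge K (x + z) ^ 2 / 2 - 1 / 2 - ⟪dualityMap K x, z⟫ -
        ⟪fderiv ℝ (dualityMap K) x z, z⟫ / 2| ≤
          ε / 2 * ⟪fderiv ℝ (dualityMap K) x z, z⟫ := by
    intro z hz
    refine (htay x hx z hz).trans ?_
    have := mul_le_mul_of_nonneg_left (hell x hx z) hε.le
    linarith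
  constructor
  · rintro y ⟨h1, h2⟩
    obtain ⟨z, rfl⟩ : ∃ z, y = x + z := ⟨y - x, by abel⟩
    rw [add_sub_cancel_left] at h1
    refine ⟨?_, h2⟩
    rw [inner_add_right, hxx] at h2
    have hq := hell x hx z
    have hq0 : 0 ≤ ⟪fderiv ℝ (dualityMap K) x z, z⟫ :=
      hK.inner_fderiv_dualityMap_nonneg hx0 z
    have hz : ‖z‖ < η := by
      by_contra! hge
      have : η ^ 2 ≤ ‖z‖ ^ 2 := by gcongr
      nlinarith
    have h3 := (abs_le.1 (hnear z hz)).2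
    rw [← hK.gauge_le_one_iff, ← sq_le_one_iff₀ (gauge_nonneg _)]
    linarith
  · rintro y ⟨h1, h2⟩
    obtain ⟨z, rfl⟩ : ∃ z, y = x + z := ⟨y - x, by abel⟩
    refine ⟨?_, h2⟩
    rw [add_sub_cancel_left]
    have hz : ‖z‖ < η := by
      by_contra! hge
      have := hsep x hx (x + z) h1 (by rwa [add_sub_cancel_left])
      linarith
    have h3 := (abs_le.1 (hnear z hz)).1
    rw [← hK.gauge_le_one_iff, ← sq_le_one_iff₀ (gauge_nonneg _)] at h1
    linarith

end PolarFloating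

/-! ### Uniform asymptotics and continuity of cap volumes. -/

namespace PolarFloating

variable {n : ℕ} {K : Set (Space n)}

/-- The leading term of the volume of the cap `{y ∈ K | 1 - τ ≤ ⟪dualityMap K x, y⟫}`. -/
noncomputable def capTerm (K : Set (Space n)) (x : Space n) (τ : ℝ) : ℝ :=
  volume.real (Metric.ball (0 : Space (n - 1)) 1) / (n + 1) * (2 * τ) ^ (((n : ℝ) + 1) / 2) *
    (√(dualityJacobian K x))⁻¹

lemma IsRegularBody.capTerm_pos (hK : IsRegularBody K) {x : Space n} (hx : x ≠ 0) {τ : ℝ}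
    (hτ : 0 < τ) : 0 < capTerm K x τ := by
  have h1 : 0 < volume.real (Metric.ball (0 : Space (n - 1)) 1) :=
    ENNReal.toReal_pos (Metric.measure_ball_pos _ _ one_pos).ne' measure_ball_lt_top.ne
  have h2 := hK.dualityJacobian_pos x hx
  rw [capTerm]
  positivity

lemma capTerm_mul {x : Space n} {c τ : ℝ} (hc : 0 ≤ c) (hτ : 0 ≤ τ) :
    capTerm K x (c * τ) = c ^ (((n : ℝ) + 1) / 2) * capTerm K x τ := by
  rw [capTerm, capTerm, mul_left_comm, Real.mul_rpow hc (by positivity)]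
  ring

lemma IsBody.measure_lt_top (hK : IsBody K) (p : Space n → Prop) :
    volume {y | y ∈ K ∧ p y} ≠ ⊤ :=
  measure_ne_top_of_subset (fun _ hy => hy.1) hK.isCompact.measure_lt_top.ne

namespace IsRegularBody

variable [NeZero n]

lemma ellipsoidCap_bounds (hK : IsRegularBody K) {x : Space n} (hx : x ∈ frontier K) {c τ : ℝ}
    (hc : 0 < c) (hτ : 0 < τ) (hcτ : c * τ ≤ 1) :
    (c ^ n)⁻¹ * c ^ (((n : ℝ) + 1) / 2) * (1 - c * τ / 2) ^ (((n : ℝ) - 1) / 2) * capTerm K x τ ≤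
      volume.real (ellipsoidCap K x c τ) ∧
    volume.real (ellipsoidCap K x c τ) ≤
      (c ^ n)⁻¹ * c ^ (((n : ℝ) + 1) / 2) * capTerm K x τ := by
  obtain ⟨e, he, hvol⟩ := hK.volume_ellipsoidCap hx (c := c) (τ := τ) hc
  obtain ⟨h1, h2⟩ := ball_cap_bounds (n := n) he (mul_pos hc hτ) hcτ
  have hcap := capTerm_mul (K := K) (x := x) hc.le hτ.le
  have hfac : 0 ≤ (c ^ n)⁻¹ * (√(dualityJacobian K x))⁻¹ := by positivity
  rw [hvol]
  constructor
  · refine le_trans (le_of_eq ?_) (mul_le_mul_of_nonneg_left h1 hfac)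
    calc _ = (c ^ n)⁻¹ * (1 - c * τ / 2) ^ (((n : ℝ) - 1) / 2) * capTerm K x (c * τ) := by
          rw [hcap]; ring
      _ = _ := by rw [capTerm]; ring
  · refine (mul_le_mul_of_nonneg_left h2 hfac).trans (le_of_eq ?_)
    calc _ = (c ^ n)⁻¹ * capTerm K x (c * τ) := by rw [capTerm]; ring
      _ = _ := by rw [hcap]; ring

/-- The volume of a small cap is asymptotic to `capTerm`, uniformly over the boundary. -/
lemma exists_capTerm_bounds (hK : IsRegularBody K) {ε : ℝ} (hε : 0 < ε) :
    ∃ τ₀ > 0, ∀ x ∈ frontier K, ∀ τ, 0 < τ → τ < τ₀ →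
      (1 - ε) * capTerm K x τ ≤ volume.real {y | y ∈ K ∧ 1 - τ ≤ ⟪dualityMap K x, y⟫} ∧
      volume.real {y | y ∈ K ∧ 1 - τ ≤ ⟪dualityMap K x, y⟫} ≤ (1 + ε) * capTerm K x τ := by
  have hlow : Tendsto (fun s : ℝ => ((1 + s) ^ n)⁻¹ * (1 + s) ^ (((n : ℝ) + 1) / 2) *
      (1 - (1 + s) * s / 2) ^ (((n : ℝ) - 1) / 2)) (𝓝 0) (𝓝 1) := by
    have : ContinuousAt (fun s : ℝ => ((1 + s) ^ n)⁻¹ * (1 + s) ^ (((n : ℝ) + 1) / 2) *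
        (1 - (1 + s) * s / 2) ^ (((n : ℝ) - 1) / 2)) 0 := by
      refine ((ContinuousAt.inv₀ (by fun_prop) (by simp)).mul
        (ContinuousAt.rpow_const (by fun_prop) (by simp))).mul
        (ContinuousAt.rpow_const (by fun_prop) (by simp))
    simpa [ContinuousAt] using this
  have hup : Tendsto (fun s : ℝ => ((1 - s) ^ n)⁻¹ * (1 - s) ^ (((n : ℝ) + 1) / 2))
      (𝓝 0) (𝓝 1) := by
    have : ContinuousAt (fun s : ℝ => ((1 - s) ^ n)⁻¹ * (1 - s) ^ (((n : ℝ) + 1) / 2)) 0 :=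
      (ContinuousAt.inv₀ (by fun_prop) (by simp)).mul
        (ContinuousAt.rpow_const (by fun_prop) (by simp))
    simpa [ContinuousAt] using this
  obtain ⟨s, ⟨hs1, hs2⟩, hs0, hs3⟩ := (((hlow.eventually (lt_mem_nhds
    (by linarith : 1 - ε < 1))).and (hup.eventually (gt_mem_nhds (by linarith : 1 < 1 + ε)))).filter_mono
      (nhdsWithin_le_nhds (s := Set.Ioi 0)) |>.and (Ioo_mem_nhdsGT (by norm_num : (0 : ℝ) < 1 / 2))).exists
  obtain ⟨τ₀, hτ₀, hsub⟩ := hK.exists_ellipsoidCap_subset hs0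
  refine ⟨min τ₀ s, lt_min hτ₀ hs0, fun x hx τ hτ hττ => ?_⟩
  obtain ⟨hsub1, hsub2⟩ := hsub x hx τ (hττ.trans_le (min_le_left _ _))
  have hτs : τ < s := hττ.trans_le (min_le_right _ _)
  have hA := hK.capTerm_pos (hK.ne_zero hx) hτ
  have hn : (1 : ℝ) ≤ n := by exact_mod_cast NeZero.one_le
  obtain ⟨h1, -⟩ := hK.ellipsoidCap_bounds hx (c := 1 + s) (by linarith) hτ (by nlinarith)
  obtain ⟨h2, h3⟩ := hK.ellipsoidCap_bounds hx (c := 1 - s) (by linarith) hτ (by nlinarith)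
  constructor
  · refine le_trans ?_ (h1.trans (measureReal_mono hsub1 (hK.measure_lt_top _)))
    refine mul_le_mul_of_nonneg_right (hs1.le.trans ?_) hA.le
    have : 0 ≤ 1 - (1 + s) * s / 2 := by nlinarith
    have hpos : 0 < 1 + s := by linarith
    gcongr
  -- Infinite volume has real value 0, which would contradict the positive lower bound `h2`.
  · have hne : volume (ellipsoidCap K x (1 - s) τ) ≠ ⊤ := by
      intro htop
      have h0 : volume.real (ellipsoidCap K x (1 - s) τ) = 0 := by
        rw [measureReal_def, htop, ENNReal.toReal_top]
      rw [h0] at h2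
      have hp1 : 0 < 1 - s := by linarith
      have hp2 : 0 < 1 - (1 - s) * τ / 2 := by nlinarith
      have : 0 < ((1 - s) ^ n)⁻¹ * (1 - s) ^ (((n : ℝ) + 1) / 2) *
        (1 - (1 - s) * τ / 2) ^ (((n : ℝ) - 1) / 2) * capTerm K x τ := by positivity
      linarith
    refine (measureReal_mono hsub2 hne).trans (h3.trans ?_)
    exact mul_le_mul_of_nonneg_right hs2.le hA.le

/-- The leading term is homogeneous in τ of degree (n + 1)/2 ≥ 1, so changing τ by a factor 1 ± ε
outweighs a relative error ε/4. The asymptotics of volumes thus become a comparison of heights. -/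
lemma exists_capTerm_separation (hK : IsRegularBody K) {ε : ℝ} (hε : 0 < ε) (hε1 : ε < 1) :
    ∃ τ₀ > 0, ∀ x ∈ frontier K, ∀ τ, 0 < τ → τ < τ₀ →
      volume.real {y | y ∈ K ∧ 1 - (1 - ε) * τ ≤ ⟪dualityMap K x, y⟫} < capTerm K x τ ∧
      capTerm K x τ < volume.real {y | y ∈ K ∧ 1 - (1 + ε) * τ ≤ ⟪dualityMap K x, y⟫} := by
  obtain ⟨τ₀, hτ₀, h⟩ := hK.exists_capTerm_bounds (ε := ε / 4) (by positivity)
  refine ⟨τ₀ / 2, by positivity, fun x hx τ hτ hττ => ?_⟩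
  have hA := hK.capTerm_pos (hK.ne_zero hx) hτ
  have hn : (1 : ℝ) ≤ n := by exact_mod_cast NeZero.one_le
  have hN : 1 ≤ ((n : ℝ) + 1) / 2 := by linarith
  constructor
  · refine (h x hx ((1 - ε) * τ) (by nlinarith) (by nlinarith)).2.trans_lt ?_
    rw [capTerm_mul (by linarith) hτ.le, ← mul_assoc]
    have h1 : (1 - ε) ^ (((n : ℝ) + 1) / 2) ≤ 1 - ε := by
      have := Real.rpow_le_rpow_of_exponent_ge (by linarith : 0 < 1 - ε) (by linarith) hN
      rwa [Real.rpow_one] at this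
    have h2 : (1 + ε / 4) * (1 - ε) ^ (((n : ℝ) + 1) / 2) < 1 := by nlinarith
    nlinarith
  · refine lt_of_lt_of_le ?_ (h x hx ((1 + ε) * τ) (by nlinarith) (by nlinarith)).1
    rw [capTerm_mul (by linarith) hτ.le, ← mul_assoc]
    have h1 : 1 + ε ≤ (1 + ε) ^ (((n : ℝ) + 1) / 2) := by
      have := Real.rpow_le_rpow_of_exponent_le (by linarith : 1 ≤ 1 + ε) hN
      rwa [Real.rpow_one] at this
    have h2 : 1 < (1 - ε / 4) * (1 + ε) ^ (((n : ℝ) + 1) / 2) := by nlinarith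
    nlinarith

end IsRegularBody

lemma volume_hyperplane_eq_zero {v : Space n} (hv : v ≠ 0) (a : ℝ) :
    volume {y : Space n | ⟪v, y⟫ = a} = 0 := by
  have hset : {y : Space n | ⟪v, y⟫ = a} =
      (AffineSubspace.comap (innerSL ℝ v : Space n →L[ℝ] ℝ).toLinearMap.toAffineMap
        (AffineSubspace.mk' a ⊥) : Set (Space n)) := by
    ext y
    simp [sub_eq_zero]
  rw [hset]
  refine Measure.addHaar_affineSubspace _ _ fun htop => ?_
  have h1 : ∀ y, ⟪v, y⟫ = a := fun y => by
    have : y ∈ (⊤ : AffineSubspace ℝ (Space n)) := AffineSubspace.mem_top ..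
    rw [← htop, ← SetLike.mem_coe, ← hset] at this
    exact this
  have h2 := h1 v
  rw [← h1 0, inner_zero_right] at h2
  exact hv (inner_self_eq_zero.1 h2)

/-- Dominated convergence: for fixed s, the indicator of the cap varies continuously at s except for
y on a null hyperplane. The continuity serves to realise a prescribed cap volume. -/
lemma IsBody.continuous_cap (hK : IsBody K) {v : Space n} (hv : v ≠ 0) :
    Continuous fun s : ℝ => volume.real {y | y ∈ K ∧ s ≤ ⟪v, y⟫} := by
  have hKm := hK.isCompact.measurableSet
  have hint : ∀ s : ℝ, volume.real {y | y ∈ K ∧ s ≤ ⟪v, y⟫} =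
      ∫ y in K, Set.indicator {y : Space n | s ≤ ⟪v, y⟫} (fun _ => (1 : ℝ)) y := by
    intro s
    have hm : MeasurableSet {y : Space n | s ≤ ⟪v, y⟫} :=
      (isClosed_le continuous_const (by fun_prop)).measurableSet
    rw [integral_indicator hm, setIntegral_const, smul_eq_mul, mul_one, measureReal_restrict_apply hm]
    congr 1
    ext y
    exact and_comm
  simp_rw [hint]
  have : Fact (volume K < ⊤) := ⟨hK.isCompact.measure_lt_top⟩
  refine continuous_iff_continuousAt.2 fun s => continuousAt_of_dominated
    (bound := fun _ => 1) ?_ ?_ (integrable_const _) ?_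
  · refine Eventually.of_forall fun r => ?_
    exact (measurable_const.indicator
      (isClosed_le continuous_const (by fun_prop)).measurableSet).aestronglyMeasurable
  · refine Eventually.of_forall fun r => Eventually.of_forall fun y => ?_
    exact (norm_indicator_le_norm_self _ _).trans (by simp)
  · have h0 : ∀ᵐ y : Space n, ⟪v, y⟫ ≠ s := by
      rw [ae_iff]
      simpa using volume_hyperplane_eq_zero hv s
    filter_upwards [ae_restrict_of_ae h0] with y hy
    rcases lt_or_gt_of_ne hy with h | h
    · refine (continuousAt_const (y := (0 : ℝ))).congr ?_
      filter_upwards [lt_mem_nhds h] with r hr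
      have hmem : y ∉ {y : Space n | r ≤ ⟪v, y⟫} := not_le.2 hr
      exact (Set.indicator_of_notMem hmem _).symm
    · refine (continuousAt_const (y := (1 : ℝ))).congr ?_
      filter_upwards [gt_mem_nhds h] with r hr
      have hmem : y ∈ {y : Space n | r ≤ ⟪v, y⟫} := hr.le
      exact (Set.indicator_of_mem hmem fun _ => (1 : ℝ)).symm

end PolarFloating

/-! ### Floating bodies with a continuous weight, and their polars. -/

namespace PolarFloating

variable {n : ℕ} {K : Set (Space n)}

/-- A positive function that is homogeneous of degree `0` and continuous off the origin. -/
structure IsAngularWeight (f : Space n → ℝ) : Prop where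
  continuousAt : ∀ x, x ≠ 0 → ContinuousAt f x
  smul : ∀ x, x ≠ 0 → ∀ t : ℝ, 0 < t → f (t • x) = f x
  pos : ∀ x, x ≠ 0 → 0 < f x

/-- The floating body of `K` that cuts off caps of relative height approximately `t * f`. -/
def weightedFloatingBody (K : Set (Space n)) (f : Space n → ℝ) (t : ℝ) : Set (Space n) :=
  floatingBody K fun u => capTerm K (boundaryPoint K u) (t * f (boundaryPoint K u))

lemma convex_floatingBody (δ : Space n → ℝ) : Convex ℝ (floatingBody K δ) := by
  have : floatingBody K δ = ⋂ (u : Space n) (_ : ‖u‖ = 1) (s : ℝ) (_ : capVolume K u s = δ u),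
      {y | ⟪u, y⟫ ≤ s} := by
    ext y
    simp [floatingBody]
  rw [this]
  exact convex_iInter fun u => convex_iInter fun _ => convex_iInter fun s => convex_iInter fun _ =>
    convex_halfSpace_le (innerSL ℝ u : Space n →L[ℝ] ℝ).isLinear s

lemma isClosed_floatingBody (δ : Space n → ℝ) : IsClosed (floatingBody K δ) := by
  have : floatingBody K δ = ⋂ (u : Space n) (_ : ‖u‖ = 1) (s : ℝ) (_ : capVolume K u s = δ u),
      {y | ⟪u, y⟫ ≤ s} := by
    ext y
    simp [floatingBody]
  rw [this]
  exact isClosed_iInter fun u => isClosed_iInter fun _ => isClosed_iInter fun s =>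
    isClosed_iInter fun _ => isClosed_le (by fun_prop) continuous_const

namespace IsRegularBody

lemma exists_unit_eq (hK : IsRegularBody K) {u : Space n} (hu : ‖u‖ = 1) :
    ∃ x ∈ frontier K, u = ‖dualityMap K x‖⁻¹ • dualityMap K x := by
  have hu0 : u ≠ 0 := norm_ne_zero_iff.1 (by rw [hu]; exact one_ne_zero)
  obtain ⟨x, hx0, hx⟩ := hK.exists_dualityMap_eq hu0
  have hg := hK.gauge_pos hx0
  refine ⟨_, hK.radial_mem hx0, ?_⟩
  rw [hK.dualityMap_smul hx0 (inv_pos.2 hg), hx, norm_smul, hu, Real.norm_of_nonneg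
    (inv_nonneg.2 hg.le), mul_one, inv_inv, smul_smul, mul_inv_cancel₀ hg.ne', one_smul]

lemma capVolume_eq (hK : IsRegularBody K) {x : Space n} (hx : x ∈ frontier K) (s : ℝ) :
    capVolume K (‖dualityMap K x‖⁻¹ • dualityMap K x) s =
      volume.real {y | y ∈ K ∧ ‖dualityMap K x‖ * s ≤ ⟪dualityMap K x, y⟫} := by
  have hG : 0 < ‖dualityMap K x‖ := norm_pos_iff.2 (hK.dualityMap_ne_zero (hK.ne_zero hx))
  rw [capVolume]
  congr 1
  ext y
  simp only [Set.mem_ofPred_eq, real_inner_smul_left]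
  rw [le_inv_mul_iff₀ hG]

lemma exists_angular_bound (hK : IsRegularBody K) {f : Space n → ℝ} (hf : IsAngularWeight f) :
    ∃ M > 0, ∀ x ∈ frontier K, f x ≤ M := by
  obtain ⟨M, hM⟩ := hK.isCompact_frontier.exists_bound_of_continuousOn
    (fun x hx => (hf.continuousAt x (hK.ne_zero hx)).continuousWithinAt)
  exact ⟨max M 1, by positivity, fun x hx => (le_abs_self _).trans ((hM x hx).trans (le_max_left _ _))⟩

lemma mem_of_forall_inner_le (hK : IsRegularBody K) {y : Space n} {c : ℝ}
    (hc : 0 ≤ c) (hy : ∀ x ∈ frontier K, ⟪dualityMap K x, y⟫ ≤ c) : gauge K y ≤ c := by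
  rcases eq_or_ne y 0 with rfl | hy0
  · rwa [gauge_zero]
  · have hg := hK.gauge_pos hy0
    have := hy _ (hK.radial_mem hy0)
    rwa [hK.dualityMap_smul hy0 (inv_pos.2 hg), real_inner_smul_left,
      hK.inner_dualityMap_self hy0, sq, inv_mul_cancel_left₀ hg.ne'] at this

variable [NeZero n]

/-- The weighted floating bodies are squeezed between two Wulff shapes. -/
lemma exists_floatingBody_sandwich (hK : IsRegularBody K) {f : Space n → ℝ}
    (hf : IsAngularWeight f) {ε : ℝ} (hε : 0 < ε) (hε1 : ε < 1) :
    ∃ t₀ > 0, ∀ t, 0 < t → t < t₀ →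
      (∀ y ∈ weightedFloatingBody K f t, ∀ x ∈ frontier K,
        ⟪dualityMap K x, y⟫ ≤ 1 - (1 - ε) * (t * f x)) ∧
      (∀ y, (∀ x ∈ frontier K, ⟪dualityMap K x, y⟫ ≤ 1 - (1 + ε) * (t * f x)) →
        y ∈ weightedFloatingBody K f t) := by
  obtain ⟨τ₀, hτ₀, hsep⟩ := hK.exists_capTerm_separation hε hε1
  obtain ⟨M, hM, hfM⟩ := hK.exists_angular_bound hf
  refine ⟨τ₀ / M, by positivity, fun t ht htt => ?_⟩
  have hτ : ∀ x ∈ frontier K, 0 < t * f x ∧ t * f x < τ₀ := fun x hx =>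
    ⟨mul_pos ht (hf.pos x (hK.ne_zero hx)), by
      rw [lt_div_iff₀ hM] at htt
      exact (mul_le_mul_of_nonneg_left (hfM x hx) ht.le).trans_lt htt⟩
  have hanti : ∀ x, ∀ a b : ℝ, volume.real {y | y ∈ K ∧ a ≤ ⟪dualityMap K x, y⟫} <
      volume.real {y | y ∈ K ∧ b ≤ ⟪dualityMap K x, y⟫} → b < a := by
    intro x a b hab
    by_contra! hle
    exact absurd hab (not_lt.2 (measureReal_mono (fun y hy => ⟨hy.1, hle.trans hy.2⟩)
      (hK.measure_lt_top _)))
  constructor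
  · intro y hy x hx
    have hG0 := hK.dualityMap_ne_zero (hK.ne_zero hx)
    have hG : 0 < ‖dualityMap K x‖ := norm_pos_iff.2 hG0
    obtain ⟨h1, h2⟩ := hsep x hx _ (hτ x hx).1 (hτ x hx).2
    have hle : 1 - (1 + ε) * (t * f x) ≤ 1 - (1 - ε) * (t * f x) := (hanti x _ _ (h1.trans h2)).le
    -- The definition of the floating body constrains y only through levels that attain the
    -- prescribed volume, so such a level must be produced. The opposite inclusion needs only
    -- monotonicity of cap volumes.
    obtain ⟨σ, -, hσ⟩ := intermediate_value_Icc' hle (hK.continuous_cap hG0).continuousOn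
      ⟨h1.le, h2.le⟩
    simp only at hσ
    have hu : ‖‖dualityMap K x‖⁻¹ • dualityMap K x‖ = 1 := by
      rw [norm_smul, norm_inv, norm_norm, inv_mul_cancel₀ hG.ne']
    have h3 := hy _ hu (‖dualityMap K x‖⁻¹ * σ) (by
      rw [hK.capVolume_eq hx, mul_inv_cancel_left₀ hG.ne', hσ]
      beta_reduce
      rw [hK.boundaryPoint_eq hx])
    rw [real_inner_smul_left, mul_le_mul_iff_right₀ (inv_pos.2 hG)] at h3
    rw [← hσ] at h1
    exact h3.trans (hanti x _ _ h1).le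
  · intro y hy u hu s hs
    obtain ⟨x, hx, rfl⟩ := hK.exists_unit_eq hu
    have hG : 0 < ‖dualityMap K x‖ := norm_pos_iff.2 (hK.dualityMap_ne_zero (hK.ne_zero hx))
    obtain ⟨-, h2⟩ := hsep x hx _ (hτ x hx).1 (hτ x hx).2
    beta_reduce at hs
    rw [hK.boundaryPoint_eq hx, hK.capVolume_eq hx] at hs
    rw [← hs] at h2
    rw [real_inner_smul_left, inv_mul_le_iff₀ hG]
    exact (hy x hx).trans (hanti x _ _ h2).le

/-- For small parameters the weighted floating bodies are convex bodies around the origin. -/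
lemma exists_isBody_floatingBody (hK : IsRegularBody K) {f : Space n → ℝ}
    (hf : IsAngularWeight f) :
    ∃ t₀ > 0, ∀ t, 0 < t → t < t₀ → IsBody (weightedFloatingBody K f t) := by
  obtain ⟨t₀, ht₀, h⟩ := hK.exists_floatingBody_sandwich hf (ε := 1 / 2) (by norm_num)
    (by norm_num)
  obtain ⟨M, hM, hfM⟩ := hK.exists_angular_bound hf
  -- With ε = 1/2 and t M ≤ 1/3 the inner Wulff shape has 1 - (3/2) t f ≥ 1/2, so it contains {g <
  -- 1/2}.
  refine ⟨min t₀ (1 / (3 * M)), by positivity, fun t ht htt => ?_⟩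
  obtain ⟨h1, h2⟩ := h t ht (htt.trans_le (min_le_left _ _))
  have htM : t * M ≤ 1 / 3 := by
    have := (htt.trans_le (min_le_right _ _)).le
    rw [le_div_iff₀ (by positivity)] at this
    linarith
  refine ⟨convex_floatingBody _, ?_, ?_⟩
  · refine hK.isCompact.of_isClosed_subset (isClosed_floatingBody _) fun y hy => ?_
    rw [← hK.gauge_le_one_iff]
    refine hK.mem_of_forall_inner_le zero_le_one fun x hx => ?_
    have h3 := h1 y hy x hx
    have h4 := mul_pos ht (hf.pos x (hK.ne_zero hx))
    linarith
  · rw [mem_interior_iff_mem_nhds]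
    have h0 : ∀ᶠ y in 𝓝 (0 : Space n), gauge K y < 1 / 2 :=
      hK.continuous_gauge.continuousAt.eventually (gt_mem_nhds (by rw [gauge_zero]; norm_num))
    filter_upwards [h0] with y hy
    refine h2 y fun x hx => ?_
    have h3 := hK.inner_dualityMap_le (hK.ne_zero hx) y
    rw [hK.mem_frontier_iff.1 hx, one_mul] at h3
    have h4 := mul_le_mul_of_nonneg_left (hfM x hx) ht.le
    linarith

/-- First order lower bound for the support function of the weighted floating bodies. -/
lemma exists_smul_mem_floatingBody (hK : IsRegularBody K) {f : Space n → ℝ}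
    (hf : IsAngularWeight f) {ε : ℝ} (hε : 0 < ε) (hε1 : ε < 1) :
    ∃ t₀ > 0, ∀ t, 0 < t → t < t₀ → ∀ x ∈ frontier K,
      (1 - t * ((1 + ε) * f x + ε)) • x ∈ weightedFloatingBody K f t := by
  obtain ⟨t₀, ht₀, h⟩ := hK.exists_floatingBody_sandwich hf hε hε1
  obtain ⟨M, hM, hfM⟩ := hK.exists_angular_bound hf
  have hu := hK.isCompact_frontier.uniformContinuousAt_of_continuousAt f
    (fun x hx => hf.continuousAt x (hK.ne_zero hx)) (Metric.dist_mem_uniformity (half_pos hε))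
  obtain ⟨η, hη, hηu⟩ := Metric.mem_uniformity_dist.1 hu
  obtain ⟨c, hc, hsep⟩ := hK.exists_inner_le_one_sub hη
  refine ⟨min t₀ (min (min c 1 / (2 * M)) (1 / (2 * M + 1))), by positivity,
    fun t ht htt x hx => ?_⟩
  have htt0 := htt.trans_le (min_le_left _ _)
  have htt1 := (htt.trans_le (min_le_right _ _)).trans_le (min_le_left _ _)
  have htt2 := (htt.trans_le (min_le_right _ _)).trans_le (min_le_right _ _)
  rw [lt_div_iff₀ (by positivity)] at htt1 htt2
  refine (h t ht htt0).2 _ fun x' hx' => ?_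
  have hfx := hf.pos x (hK.ne_zero hx)
  have hfx' := hf.pos x' (hK.ne_zero hx')
  have hM1 := hfM x hx
  have hM2 := hfM x' hx'
  have ha0 : 0 ≤ 1 - t * ((1 + ε) * f x + ε) := by
    have : (1 + ε) * f x + ε ≤ 2 * M + 1 := by nlinarith
    nlinarith
  have ha1 : 1 - t * ((1 + ε) * f x + ε) ≤ 1 := by
    have : 0 < (1 + ε) * f x + ε := by positivity
    nlinarith
  rw [inner_smul_right]
  -- Near x the weight varies by less than ε/2, and (1 + ε) ε/2 ≤ ε is absorbed by the extra ε. Far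
  -- from x, strict convexity leaves a gap min(c, 1) that exceeds the perturbation of at most 2 t M.
  rcases lt_or_ge ‖x - x'‖ η with hnear | hfar
  · have h1 := hηu (a := x') (b := x) (by rwa [dist_comm, dist_eq_norm]) hx'
    rw [Set.mem_ofPred_eq, Real.dist_eq] at h1
    have h2 := (abs_lt.1 h1).2
    have h3 := hK.inner_dualityMap_le (hK.ne_zero hx') x
    rw [hK.mem_frontier_iff.1 hx', hK.mem_frontier_iff.1 hx, one_mul] at h3
    have h4 : (1 + ε) * f x' ≤ (1 + ε) * f x + ε := by nlinarith
    have h5 := mul_le_mul_of_nonneg_left h4 ht.le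
    nlinarith [mul_le_mul_of_nonneg_left h3 ha0]
  · have h1 := hsep x' hx' x (hK.isCompact.isClosed.frontier_subset hx) hfar
    have h2 : ⟪dualityMap K x', x⟫ ≤ 1 - min c 1 := h1.trans (by linarith [min_le_left c 1])
    have h3 : 0 ≤ 1 - min c 1 := by linarith [min_le_right c 1]
    have h4 := mul_le_mul_of_nonneg_left h2 ha0
    have h5 : (1 - t * ((1 + ε) * f x + ε)) * (1 - min c 1) ≤ 1 - min c 1 :=
      mul_le_of_le_one_left h3 ha1
    have h6 : (1 + ε) * (t * f x') ≤ t * (2 * M) := by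
      have : (1 + ε) * f x' ≤ 2 * M := by nlinarith
      nlinarith
    linarith

/-- The polar of a weighted floating body in the coordinates given by the duality map. -/
lemma exists_polar_floatingBody_sandwich (hK : IsRegularBody K) {f : Space n → ℝ}
    (hf : IsAngularWeight f) {ε : ℝ} (hε : 0 < ε) (hε1 : ε < 1) :
    ∃ t₀ > 0, ∀ t, 0 < t → t < t₀ → ∀ x, x ≠ 0 →
      (dualityMap K x ∈ polarBody (weightedFloatingBody K f t) →
        gauge K x * (1 - t * ((1 + ε) * f x + ε)) ≤ 1) ∧
      (gauge K x * (1 - t * ((1 - ε) * f x)) ≤ 1 →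
        dualityMap K x ∈ polarBody (weightedFloatingBody K f t)) := by
  obtain ⟨t₁, ht₁, h₁⟩ := hK.exists_floatingBody_sandwich hf hε hε1
  obtain ⟨t₂, ht₂, h₂⟩ := hK.exists_smul_mem_floatingBody hf hε hε1
  refine ⟨min t₁ t₂, lt_min ht₁ ht₂, fun t ht htt x hx => ?_⟩
  have hg := hK.gauge_pos hx
  have hfx : f ((gauge K x)⁻¹ • x) = f x := hf.smul x hx _ (inv_pos.2 hg)
  constructor
  · intro h
    -- Test the polar condition on the shrunk boundary point on the ray through x, which lies in the
    -- floating body.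
    have h3 := h _ (h₂ t ht (htt.trans_le (min_le_right _ _)) _ (hK.radial_mem hx))
    rw [hfx, real_inner_smul_left, real_inner_smul_left, real_inner_comm,
      hK.inner_dualityMap_self hx, sq, inv_mul_cancel_left₀ hg.ne', mul_comm] at h3
    exact h3
  · intro h y hy
    have h3 := (h₁ t ht (htt.trans_le (min_le_left _ _))).1 y hy _ (hK.radial_mem hx)
    rw [hfx, hK.dualityMap_smul hx (inv_pos.2 hg), real_inner_smul_left,
      inv_mul_le_iff₀ hg] at h3
    rw [real_inner_comm]
    refine h3.trans (le_trans (le_of_eq ?_) h)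
    ring

end IsRegularBody
end PolarFloating

/-! ### Radial integration and the volume of the polar body. -/

namespace PolarFloating

section Polar

variable {E : Type*} [NormedAddCommGroup E] [NormedSpace ℝ E] [FiniteDimensional ℝ E]
  [Nontrivial E] [MeasurableSpace E] [BorelSpace E] (μ : Measure E) [μ.IsAddHaarMeasure]

lemma lintegral_eq_lintegral_sphere {F : E → ℝ≥0∞} (hF : Measurable F) :
    ∫⁻ x, F x ∂μ = ∫⁻ u : Metric.sphere (0 : E) 1, ∫⁻ r : Set.Ioi (0 : ℝ),
      F ((r : ℝ) • (u : E)) ∂(Measure.volumeIoiPow (Module.finrank ℝ E - 1)) ∂μ.toSphere := by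
  have hmp := μ.measurePreserving_homeomorphUnitSphereProd
  have hG : Measurable fun q : Metric.sphere (0 : E) 1 × Set.Ioi (0 : ℝ) =>
      F ((q.2 : ℝ) • (q.1 : E)) := by fun_prop
  rw [← lintegral_prod _ hG.aemeasurable, ← hmp.lintegral_comp hG]
  have hcompl : ∫⁻ x, F x ∂μ = ∫⁻ x : ({0}ᶜ : Set E), F x ∂(μ.comap (↑)) := by
    rw [lintegral_subtype_comap (measurableSet_singleton _).compl, restrict_compl_singleton]
  rw [hcompl]
  refine lintegral_congr fun x => ?_
  have h := (homeomorphUnitSphereProd E).symm_apply_apply x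
  nth_rewrite 1 [← h]
  rfl

/-- Rescaling of a radial set by a function that is homogeneous of degree `0`. -/
lemma setLIntegral_mul_lt_one {g ρ : E → ℝ} {a : E → ℝ≥0∞} (hg : Measurable g) (hρ : Measurable ρ)
    (ha : Measurable a) (hg0 : ∀ x, x ≠ 0 → 0 < g x) (hρ0 : ∀ x, x ≠ 0 → 0 < ρ x)
    (hgs : ∀ x, x ≠ 0 → ∀ t : ℝ, 0 < t → g (t • x) = t * g x)
    (hρs : ∀ x, x ≠ 0 → ∀ t : ℝ, 0 < t → ρ (t • x) = ρ x)
    (has : ∀ x, x ≠ 0 → ∀ t : ℝ, 0 < t → a (t • x) = a x) :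
    ∫⁻ x in {x | g x * ρ x < 1}, a x ∂μ =
      ∫⁻ x in {x | g x < 1}, a x * ENNReal.ofReal ((ρ x ^ Module.finrank ℝ E)⁻¹) ∂μ := by
  have hfin : 0 < Module.finrank ℝ E := Module.finrank_pos
  have hm1 : MeasurableSet {x | g x * ρ x < 1} := measurableSet_lt (hg.mul hρ) measurable_const
  have hm2 : MeasurableSet {x | g x < 1} := measurableSet_lt hg measurable_const
  have hb : Measurable fun x => a x * ENNReal.ofReal ((ρ x ^ Module.finrank ℝ E)⁻¹) := by fun_prop
  rw [← lintegral_indicator hm1, ← lintegral_indicator hm2,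
    lintegral_eq_lintegral_sphere μ (ha.indicator hm1),
    lintegral_eq_lintegral_sphere μ (hb.indicator hm2)]
  refine lintegral_congr fun u => ?_
  have hu : (u : E) ≠ 0 := ne_zero_of_mem_unit_sphere u
  have hgu := hg0 _ hu
  have hρu := hρ0 _ hu
  -- Along the ray of u both integrands are constants on initial intervals, of lengths (g ρ)⁻¹ and
  -- g⁻¹. The radial density r^(dim - 1) turns the ratio of lengths into the factor ρ^(-dim).
  have h1 : ∀ r : Set.Ioi (0 : ℝ), Set.indicator {x | g x * ρ x < 1} a ((r : ℝ) • (u : E)) =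
      Set.indicator (Set.Iio (⟨(g u * ρ u)⁻¹, by rw [Set.mem_Ioi]; positivity⟩ : Set.Ioi (0 : ℝ)))
        (fun _ => a u) r := by
    intro r
    have hr : 0 < (r : ℝ) := r.2
    have hiff : (r : ℝ) • (u : E) ∈ {x | g x * ρ x < 1} ↔
        r ∈ Set.Iio (⟨(g u * ρ u)⁻¹, by rw [Set.mem_Ioi]; positivity⟩ : Set.Ioi (0 : ℝ)) := by
      rw [Set.mem_ofPred_eq, hgs _ hu _ hr, hρs _ hu _ hr, Set.mem_Iio, ← Subtype.coe_lt_coe,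
        lt_inv_comm₀ hr (by positivity), inv_eq_one_div, lt_div_iff₀ hr]
      rw [mul_comm (r : ℝ), mul_right_comm]
    by_cases h : (r : ℝ) • (u : E) ∈ {x | g x * ρ x < 1}
    · rw [Set.indicator_of_mem h, Set.indicator_of_mem (hiff.1 h), has _ hu _ hr]
    · rw [Set.indicator_of_notMem h, Set.indicator_of_notMem (fun h' => h (hiff.2 h'))]
  have h2 : ∀ r : Set.Ioi (0 : ℝ), Set.indicator {x | g x < 1}
      (fun x => a x * ENNReal.ofReal ((ρ x ^ Module.finrank ℝ E)⁻¹)) ((r : ℝ) • (u : E)) =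
      Set.indicator (Set.Iio (⟨(g u)⁻¹, by rw [Set.mem_Ioi]; positivity⟩ : Set.Ioi (0 : ℝ)))
        (fun _ => a u * ENNReal.ofReal ((ρ u ^ Module.finrank ℝ E)⁻¹)) r := by
    intro r
    have hr : 0 < (r : ℝ) := r.2
    have hiff : (r : ℝ) • (u : E) ∈ {x | g x < 1} ↔
        r ∈ Set.Iio (⟨(g u)⁻¹, by rw [Set.mem_Ioi]; positivity⟩ : Set.Ioi (0 : ℝ)) := by
      rw [Set.mem_ofPred_eq, hgs _ hu _ hr, Set.mem_Iio, ← Subtype.coe_lt_coe,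
        lt_inv_comm₀ hr (by positivity), inv_eq_one_div, lt_div_iff₀ hr, mul_comm]
    by_cases h : (r : ℝ) • (u : E) ∈ {x | g x < 1}
    · rw [Set.indicator_of_mem h, Set.indicator_of_mem (hiff.1 h), has _ hu _ hr, hρs _ hu _ hr]
    · rw [Set.indicator_of_notMem h, Set.indicator_of_notMem (fun h' => h (hiff.2 h'))]
  simp_rw [h1, h2]
  rw [lintegral_indicator_const measurableSet_Iio, lintegral_indicator_const measurableSet_Iio,
    Measure.volumeIoiPow_apply_Iio, Measure.volumeIoiPow_apply_Iio, mul_assoc,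
    ← ENNReal.ofReal_mul (by positivity)]
  congr 2
  have : Module.finrank ℝ E - 1 + 1 = Module.finrank ℝ E := by omega
  simp only [this, mul_inv, mul_pow, inv_pow]
  ring

end Polar

variable {n : ℕ} {K : Set (Space n)}

lemma isClosed_polarBody (L : Set (Space n)) : IsClosed (polarBody L) := by
  have : polarBody L = ⋂ x ∈ L, {y | ⟪x, y⟫ ≤ 1} := by
    ext y
    simp [polarBody]
  rw [this]
  exact isClosed_biInter fun x _ => isClosed_le (by fun_prop) continuous_const

lemma IsAngularWeight.measurable {f : Space n → ℝ} (hf : IsAngularWeight f) : Measurable f :=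
  measurable_of_continuousOn_compl_singleton 0 fun x hx => (hf.continuousAt x hx).continuousWithinAt

lemma IsAngularWeight.mul {f g : Space n → ℝ} (hf : IsAngularWeight f)
    (hg : IsAngularWeight g) : IsAngularWeight fun x => f x * g x :=
  ⟨fun x hx => (hf.continuousAt x hx).mul (hg.continuousAt x hx),
    fun x hx t ht => by rw [hf.smul x hx t ht, hg.smul x hx t ht],
    fun x hx => mul_pos (hf.pos x hx) (hg.pos x hx)⟩

namespace IsRegularBody

lemma exists_bound_of_angular (hK : IsRegularBody K) {f : Space n → ℝ} (hf : IsAngularWeight f) :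
    ∃ M > 0, ∀ x, x ≠ 0 → f x ≤ M := by
  obtain ⟨M, hM, h⟩ := hK.exists_angular_bound hf
  refine ⟨M, hM, fun x hx => ?_⟩
  rw [← hf.smul x hx _ (inv_pos.2 (hK.gauge_pos hx))]
  exact h _ (hK.radial_mem hx)

lemma isAngularWeight_dualityJacobian (hK : IsRegularBody K) :
    IsAngularWeight (dualityJacobian K) :=
  ⟨fun _ hx => hK.continuousAt_dualityJacobian hx, fun _ hx _ ht => hK.dualityJacobian_smul hx ht,
    hK.dualityJacobian_pos⟩

variable [NeZero n]

lemma setLIntegral_gauge_mul_lt_one (hK : IsRegularBody K) {ρ : Space n → ℝ}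
    (hρ : Measurable ρ) (hρ0 : ∀ x, x ≠ 0 → 0 < ρ x)
    (hρs : ∀ x, x ≠ 0 → ∀ t : ℝ, 0 < t → ρ (t • x) = ρ x) :
    ∫⁻ x in {x | gauge K x * ρ x < 1}, ENNReal.ofReal (dualityJacobian K x) =
      ∫⁻ x in K, ENNReal.ofReal (dualityJacobian K x * (ρ x ^ n)⁻¹) := by
  have hae : {x : Space n | gauge K x < 1} =ᵐ[volume] K := by
    rw [setOfPred_gauge_lt_one_eq_interior hK.convex hK.mem_nhds]
    exact interior_ae_eq_of_null_frontier (hK.convex.addHaar_frontier volume)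
  rw [setLIntegral_mul_lt_one volume hK.continuous_gauge.measurable hρ
    hK.measurable_dualityJacobian.ennreal_ofReal (fun x hx => hK.gauge_pos hx) hρ0
    (fun x _ t ht => hK.gauge_smul ht.le x) hρs
    (fun x hx t ht => by rw [hK.dualityJacobian_smul hx ht]), setLIntegral_congr hae]
  refine lintegral_congr_ae (ae_restrict_of_ae ?_)
  filter_upwards [Measure.ae_ne volume (0 : Space n)] with x hx
  rw [ENNReal.ofReal_mul (hK.dualityJacobian_pos x hx).le, finrank_euclideanSpace_fin]

lemma integrableOn_of_angular (hK : IsRegularBody K) {f : Space n → ℝ} (hf : IsAngularWeight f) :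
    IntegrableOn f K := by
  obtain ⟨M, hM, h⟩ := hK.exists_bound_of_angular hf
  refine IntegrableOn.of_bound hK.isCompact.measure_lt_top hf.measurable.aestronglyMeasurable M
    (ae_restrict_of_ae ?_)
  filter_upwards [Measure.ae_ne volume (0 : Space n)] with x hx
  rw [Real.norm_of_nonneg (hf.pos x hx).le]
  exact h x hx

lemma volume_polarBody (hK : IsRegularBody K) :
    volume.real (polarBody K) = ∫ x in K, dualityJacobian K x := by
  have hae : (dualityMap K ⁻¹' polarBody K : Set (Space n)) =ᵐ[volume] K := by
    filter_upwards [Measure.ae_ne volume (0 : Space n)] with x hx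
    exact propext ((hK.dualityMap_mem_polarBody_iff hx).trans hK.gauge_le_one_iff)
  rw [measureReal_def, hK.volume_eq_setLIntegral (isClosed_polarBody K).measurableSet, setLIntegral_congr hae,
    integral_eq_lintegral_of_nonneg_ae]
  · refine ae_restrict_of_ae ?_
    filter_upwards [Measure.ae_ne volume (0 : Space n)] with x hx
    exact (hK.dualityJacobian_pos x hx).le
  · exact hK.measurable_dualityJacobian.aestronglyMeasurable

end IsRegularBody
end PolarFloating

/-! ### First variation of the polar volume. -/

namespace PolarFloating

/-- Bernoulli's inequality together with (1 - s)(1 + s) ≤ 1. -/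
lemma one_add_mul_le_inv_pow {s : ℝ} (hs : 0 ≤ s) (hs1 : s < 1) (n : ℕ) :
    1 + n * s ≤ ((1 - s) ^ n)⁻¹ := by
  have hpos : 0 < (1 - s) ^ n := pow_pos (by linarith) n
  rw [le_inv_comm₀ (by positivity) hpos, inv_eq_one_div, le_div_iff₀ (by positivity)]
  have h1 := one_add_mul_le_pow (a := s) (by linarith) n
  calc (1 - s) ^ n * (1 + n * s) ≤ (1 - s) ^ n * (1 + s) ^ n :=
        mul_le_mul_of_nonneg_left h1 hpos.le
    _ = ((1 - s) * (1 + s)) ^ n := (mul_pow _ _ _).symm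
    _ ≤ 1 := pow_le_one₀ (by nlinarith) (by nlinarith)

/-- Bernoulli gives (1 - s)^n ≥ 1 - n s, and the smallness of n s bounds the inverse of the right
side. -/
lemma inv_pow_le_one_add_mul {s ε : ℝ} {n : ℕ} (hε : 0 < ε) (hs : 0 ≤ s) (hs1 : s ≤ 1)
    (hns : (1 + ε) * (n * s) ≤ ε) : ((1 - s) ^ n)⁻¹ ≤ 1 + (1 + ε) * (n * s) := by
  have h1 := one_add_mul_le_pow (a := -s) (by linarith) n
  have ha : 0 ≤ n * s := by positivity
  have h2 : 1 + (n : ℝ) * -s = 1 - n * s := by ring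
  rw [h2, ← sub_eq_add_neg] at h1
  have h3 : 0 < 1 - n * s := by nlinarith
  refine inv_le_of_inv_le₀ (by positivity) (le_trans ?_ h1)
  rw [inv_eq_one_div, div_le_iff₀ (by positivity)]
  nlinarith

variable {n : ℕ} [NeZero n] {K : Set (Space n)}

namespace IsRegularBody

lemma setLIntegral_affine (hK : IsRegularBody K) {f : Space n → ℝ} (hf : IsAngularWeight f)
    {a b : ℝ} (ha : 0 ≤ a) (hb : 0 ≤ b) :
    ∫⁻ x in K, ENNReal.ofReal (dualityJacobian K x * (a + b * f x)) =
      ENNReal.ofReal (a * volume.real (polarBody K) + b * ∫ x in K, dualityJacobian K x * f x) := by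
  have hJ := hK.isAngularWeight_dualityJacobian
  have h1 := hK.integrableOn_of_angular hJ
  have h2 := hK.integrableOn_of_angular (hJ.mul hf)
  have heq : ∀ x, dualityJacobian K x * (a + b * f x) =
      a * dualityJacobian K x + b * (dualityJacobian K x * f x) := fun x => by ring
  have h3 : Integrable (fun x => dualityJacobian K x * (a + b * f x)) (volume.restrict K) := by
    simp_rw [heq]
    exact (h1.const_mul a).add (h2.const_mul b)
  rw [← ofReal_integral_eq_lintegral_ofReal h3]
  · congr 1
    simp_rw [heq]
    rw [integral_add (h1.const_mul a) (h2.const_mul b), integral_const_mul, integral_const_mul,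
      hK.volume_polarBody]
  · refine ae_restrict_of_ae ?_
    filter_upwards [Measure.ae_ne volume (0 : Space n)] with x hx
    have := hJ.pos x hx
    have := hf.pos x hx
    simp only [Pi.zero_apply]
    positivity

lemma exists_volume_polar_bounds (hK : IsRegularBody K) {f : Space n → ℝ}
    (hf : IsAngularWeight f) {ε : ℝ} (hε : 0 < ε) (hε1 : ε < 1) :
    ∃ t₀ > 0, ∀ t, 0 < t → t < t₀ →
      volume.real (polarBody K) + n * t * (1 - ε) * ∫ x in K, dualityJacobian K x * f x ≤
        volume.real (polarBody (weightedFloatingBody K f t)) ∧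
      volume.real (polarBody (weightedFloatingBody K f t)) ≤
        volume.real (polarBody K) + n * t * ((1 + ε) * ((1 + ε) *
          (∫ x in K, dualityJacobian K x * f x) + 2 * ε * volume.real (polarBody K))) := by
  obtain ⟨t₀, ht₀, h⟩ := hK.exists_polar_floatingBody_sandwich hf hε hε1
  obtain ⟨M, hM, hfM⟩ := hK.exists_bound_of_angular hf
  have hn : (1 : ℝ) ≤ n := by exact_mod_cast NeZero.one_le
  -- Since (1 + ε) f + 2ε ≤ 2(M + 1), the perturbation s of the radius satisfies 2 n s ≤ ε, hence (1
  -- + ε) n s ≤ ε as `inv_pow_le_one_add_mul` requires.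
  refine ⟨min t₀ (ε / (4 * n * (M + 1))), by positivity, fun t ht htt => ?_⟩
  have hJ := hK.isAngularWeight_dualityJacobian
  have ht1 := htt.trans_le (min_le_left _ _)
  have ht2 := htt.trans_le (min_le_right _ _)
  rw [lt_div_iff₀ (by positivity)] at ht2
  have hI : 0 ≤ ∫ x in K, dualityJacobian K x * f x := by
    refine integral_nonneg_of_ae (ae_restrict_of_ae ?_)
    filter_upwards [Measure.ae_ne volume (0 : Space n)] with x hx
    exact (mul_pos (hJ.pos x hx) (hf.pos x hx)).le
  have hV : 0 ≤ volume.real (polarBody K) := measureReal_nonneg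
  set F := weightedFloatingBody K f t
  have hvol := hK.volume_eq_setLIntegral (isClosed_polarBody F).measurableSet
  have hs : ∀ x, x ≠ 0 → 0 < t * ((1 + ε) * f x + 2 * ε) ∧
      n * (t * ((1 + ε) * f x + 2 * ε)) * 2 ≤ ε := by
    intro x hx
    have h1 := hf.pos x hx
    have h2 := hfM x hx
    refine ⟨by positivity, ?_⟩
    have h3 : (1 + ε) * f x + 2 * ε ≤ 2 * (M + 1) := by nlinarith
    have h4 : n * (t * ((1 + ε) * f x + 2 * ε)) ≤ n * (t * (2 * (M + 1))) := by gcongr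
    linarith
  have hs1 : ∀ x, x ≠ 0 → t * ((1 + ε) * f x + 2 * ε) ≤ 1 / 2 := by
    intro x hx
    obtain ⟨h1, h2⟩ := hs x hx
    nlinarith
  have hupper : volume (polarBody F) ≤ ENNReal.ofReal (volume.real (polarBody K) +
      n * t * ((1 + ε) * ((1 + ε) * (∫ x in K, dualityJacobian K x * f x) +
        2 * ε * volume.real (polarBody K)))) := by
    -- The 2ε, where the sandwich has ε, turns its weak inequality into the strict one of the radial
    -- formula.
    have hρ := hK.setLIntegral_gauge_mul_lt_one (ρ := fun x => 1 - t * ((1 + ε) * f x + 2 * ε))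
      (by have := hf.measurable; fun_prop) (fun x hx => by linarith [hs1 x hx])
      (fun x hx r hr => by rw [hf.smul x hx r hr])
    rw [hvol]
    calc _ ≤ ∫⁻ x in {x | gauge K x * (1 - t * ((1 + ε) * f x + 2 * ε)) < 1},
          ENNReal.ofReal (dualityJacobian K x) := by
          refine lintegral_mono' (Measure.restrict_mono' ?_ le_rfl) le_rfl
          filter_upwards [Measure.ae_ne volume (0 : Space n)] with x hx hxF
          have h1 := (h t ht ht1 x hx).1 hxF
          refine lt_of_lt_of_le ?_ h1
          refine mul_lt_mul_of_pos_left ?_ (hK.gauge_pos hx)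
          nlinarith
      _ = _ := hρ
      _ ≤ ∫⁻ x in K, ENNReal.ofReal (dualityJacobian K x *
          ((1 + (1 + ε) * n * t * (2 * ε)) + ((1 + ε) * n * t * (1 + ε)) * f x)) := by
          refine lintegral_mono_ae (ae_restrict_of_ae ?_)
          filter_upwards [Measure.ae_ne volume (0 : Space n)] with x hx
          refine ENNReal.ofReal_le_ofReal (mul_le_mul_of_nonneg_left ?_ (hJ.pos x hx).le)
          obtain ⟨h1, h2⟩ := hs x hx
          refine (inv_pow_le_one_add_mul hε h1.le (by linarith [hs1 x hx]) ?_).trans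
            (le_of_eq (by ring))
          have : 0 ≤ (n : ℝ) * (t * ((1 + ε) * f x + 2 * ε)) := by positivity
          nlinarith
      _ = _ := by
          rw [hK.setLIntegral_affine hf (by positivity) (by positivity)]
          congr 1
          ring
  have hlower : ENNReal.ofReal (volume.real (polarBody K) +
      n * t * (1 - ε) * ∫ x in K, dualityJacobian K x * f x) ≤ volume (polarBody F) := by
    have hpos : ∀ x, x ≠ 0 → 0 ≤ t * ((1 - ε) * f x) ∧ t * ((1 - ε) * f x) < 1 := by
      intro x hx
      have h1 := hf.pos x hx
      have h2 := hs1 x hx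
      have h3 : 0 < 1 - ε := by linarith
      refine ⟨by positivity, ?_⟩
      have h4 : t * ((1 - ε) * f x) ≤ t * ((1 + ε) * f x + 2 * ε) := by
        refine mul_le_mul_of_nonneg_left ?_ ht.le
        nlinarith
      linarith
    have hρ := hK.setLIntegral_gauge_mul_lt_one (ρ := fun x => 1 - t * ((1 - ε) * f x))
      (by have := hf.measurable; fun_prop) (fun x hx => by linarith [(hpos x hx).2])
      (fun x hx r hr => by rw [hf.smul x hx r hr])
    rw [hvol]
    calc _ = ∫⁻ x in K, ENNReal.ofReal (dualityJacobian K x * (1 + (n * t * (1 - ε)) * f x)) := by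
          rw [hK.setLIntegral_affine hf zero_le_one (mul_nonneg (by positivity) (by linarith)),
            one_mul]
      _ ≤ ∫⁻ x in K, ENNReal.ofReal (dualityJacobian K x *
          ((1 - t * ((1 - ε) * f x)) ^ n)⁻¹) := by
          refine lintegral_mono_ae (ae_restrict_of_ae ?_)
          filter_upwards [Measure.ae_ne volume (0 : Space n)] with x hx
          refine ENNReal.ofReal_le_ofReal (mul_le_mul_of_nonneg_left ?_ (hJ.pos x hx).le)
          refine le_trans (le_of_eq (by ring))
            (one_add_mul_le_inv_pow (hpos x hx).1 (hpos x hx).2 n)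
      _ = _ := hρ.symm
      _ ≤ _ := by
          refine lintegral_mono' (Measure.restrict_mono' ?_ le_rfl) le_rfl
          filter_upwards [Measure.ae_ne volume (0 : Space n)] with x hx hxF
          have hxF : gauge K x * (1 - t * ((1 - ε) * f x)) < 1 := hxF
          exact (h t ht ht1 x hx).2 hxF.le
  constructor
  · have h1 := ENNReal.toReal_mono (ne_top_of_le_ne_top ENNReal.ofReal_ne_top hupper) hlower
    rwa [ENNReal.toReal_ofReal (add_nonneg hV
      (mul_nonneg (mul_nonneg (by positivity) (by linarith)) hI))] at h1
  · have h1 := ENNReal.toReal_mono ENNReal.ofReal_ne_top hupper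
    rwa [ENNReal.toReal_ofReal (by positivity)] at h1

/-- The derivative at `t = 0` of the volume of the polar of the weighted floating body. -/
theorem tendsto_volume_polar_quotient (hK : IsRegularBody K) {f : Space n → ℝ}
    (hf : IsAngularWeight f) :
    Tendsto (fun t => (volume.real (polarBody (weightedFloatingBody K f t)) -
      volume.real (polarBody K)) / t) (𝓝[>] 0)
      (𝓝 (n * ∫ x in K, dualityJacobian K x * f x)) := by
  set I := ∫ x in K, dualityJacobian K x * f x
  set V := volume.real (polarBody K)
  have hlow : Tendsto (fun ε : ℝ => n * (1 - ε) * I) (𝓝[>] 0) (𝓝 (n * I)) := by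
    refine (Continuous.tendsto' (by fun_prop) 0 _ (by simp)).mono_left nhdsWithin_le_nhds
  have hup : Tendsto (fun ε : ℝ => n * ((1 + ε) * ((1 + ε) * I + 2 * ε * V))) (𝓝[>] 0)
      (𝓝 (n * I)) := by
    refine (Continuous.tendsto' (by fun_prop) 0 _ (by simp)).mono_left nhdsWithin_le_nhds
  have hIoo : Set.Ioo (0 : ℝ) 1 ∈ 𝓝[>] (0 : ℝ) := Ioo_mem_nhdsGT one_pos
  refine tendsto_order.2 ⟨fun a ha => ?_, fun b hb => ?_⟩
  · obtain ⟨ε, hε, hε0, hε1⟩ := ((hlow.eventually (lt_mem_nhds ha)).and hIoo).exists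
    obtain ⟨t₀, ht₀, h⟩ := hK.exists_volume_polar_bounds hf hε0 hε1
    filter_upwards [Ioo_mem_nhdsGT ht₀] with t ht
    refine hε.trans_le ?_
    rw [le_div_iff₀ ht.1]
    linarith [(h t ht.1 ht.2).1]
  · obtain ⟨ε, hε, hε0, hε1⟩ := ((hup.eventually (gt_mem_nhds hb)).and hIoo).exists
    obtain ⟨t₀, ht₀, h⟩ := hK.exists_volume_polar_bounds hf hε0 hε1
    filter_upwards [Ioo_mem_nhdsGT ht₀] with t ht
    refine lt_of_le_of_lt ?_ hε
    rw [div_le_iff₀ ht.1]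
    linarith [(h t ht.1 ht.2).2]

end IsRegularBody
end PolarFloating

/-! ### Measurable φ(κ₀) by approximation, and the cap function. -/

namespace PolarFloating

/-- A diagonal argument along right neighbourhoods of `0`. -/
lemma exists_diagonal {X : Type*} [TopologicalSpace X] [FirstCountableTopology X]
    {q : ℕ → ℝ → X} {c : ℕ → X} {L : X} (hq : ∀ k, Tendsto (q k) (𝓝[>] 0) (𝓝 (c k)))
    (hc : Tendsto c atTop (𝓝 L)) :
    ∃ k : ℝ → ℕ, Tendsto (fun t => q (k t) t) (𝓝[>] 0) (𝓝 L) := by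
  obtain ⟨U, hU, hanti⟩ := (nhds_basis_opens L).exists_antitone_subbasis
  have h1 : ∀ j, ∃ k, ∃ T > 0, ∀ t, 0 < t → t < T → q k t ∈ U j := by
    intro j
    obtain ⟨k, hk⟩ := (hc.eventually ((hU j).2.mem_nhds (hU j).1)).exists
    obtain ⟨T, hT, h⟩ := (mem_nhdsGT_iff_exists_Ioo_subset' (zero_lt_one (α := ℝ))).1
      ((hq k).eventually ((hU j).2.mem_nhds hk))
    exact ⟨k, T, hT, fun t h0 ht => h ⟨h0, ht⟩⟩
  choose k T hT hk using h1
  -- The largest index up to 1/t whose threshold still exceeds t; it tends to infinity as t → 0. The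
  -- default value 0 is harmless, since only small t matter.
  set j : ℝ → ℕ := fun t => Nat.findGreatest (fun i => t < T i) ⌊t⁻¹⌋₊ with hj
  refine ⟨fun t => k (j t), hanti.tendsto_right_iff.2 fun i _ => ?_⟩
  have hpos : 0 < min (T i) ((i : ℝ) + 1)⁻¹ := lt_min (hT i) (by positivity)
  filter_upwards [Ioo_mem_nhdsGT hpos] with t ht
  have hle : i ≤ ⌊t⁻¹⌋₊ := by
    refine Nat.le_floor ?_
    have h2 := ht.2.trans_le (min_le_right _ _)
    rw [lt_inv_comm₀ ht.1 (by positivity)] at h2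
    linarith
  have hti : t < T i := ht.2.trans_le (min_le_left _ _)
  have h3 : t < T (j t) := Nat.findGreatest_spec (P := fun i => t < T i) hle hti
  have h4 : i ≤ j t := Nat.le_findGreatest hle hti
  exact hanti.antitone h4 (hk (j t) t ht.1 h3)

/-- Integrals of nonnegative functions are limits of integrals of continuous positive functions. -/
lemma exists_continuous_tendsto_integral {X : Type*} [TopologicalSpace X] [NormalSpace X]
    [MeasurableSpace X] [BorelSpace X] (μ : Measure X) [IsFiniteMeasure μ] [μ.WeaklyRegular]
    {a : X → ℝ} (ha : AEMeasurable a μ) (ha0 : ∀ᵐ x ∂μ, 0 ≤ a x) :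
    ∃ b : ℕ → X → ℝ, (∀ k, Continuous (b k)) ∧ (∀ k x, 0 < b k x) ∧
      Tendsto (fun k => ((∫ x, b k x ∂μ : ℝ) : EReal)) atTop
        (𝓝 ((∫⁻ x, ENNReal.ofReal (a x) ∂μ : ℝ≥0∞) : EReal)) := by
  set A : ℕ → X → ℝ := fun k x => max 0 (min (a x) k) with hA
  have hA0 : ∀ k x, 0 ≤ A k x := fun k x => le_max_left _ _
  have hAk : ∀ k x, A k x ≤ k := fun k x => max_le k.cast_nonneg (min_le_right _ _)
  have hAm : ∀ k, AEMeasurable (A k) μ := fun k => aemeasurable_const.max (ha.min aemeasurable_const)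
  have hAi : ∀ k, Integrable (A k) μ := fun k =>
    Integrable.of_bound (hAm k).aestronglyMeasurable k (Eventually.of_forall fun x => by
      rw [Real.norm_of_nonneg (hA0 k x)]; exact hAk k x)
  have hlim : Tendsto (fun k => ∫⁻ x, ENNReal.ofReal (A k x) ∂μ) atTop
      (𝓝 (∫⁻ x, ENNReal.ofReal (a x) ∂μ)) := by
    refine lintegral_tendsto_of_tendsto_of_monotone (fun k => (hAm k).ennreal_ofReal) ?_ ?_
    · refine Eventually.of_forall fun x k l hkl => ENNReal.ofReal_le_ofReal ?_
      exact max_le_max le_rfl (min_le_min le_rfl (by exact_mod_cast hkl))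
    · filter_upwards [ha0] with x hx
      refine tendsto_const_nhds.congr' ?_
      filter_upwards [eventually_ge_atTop ⌈a x⌉₊] with k hk
      have : a x ≤ k := (Nat.le_ceil _).trans (by exact_mod_cast hk)
      simp only [hA, min_eq_left this, max_eq_right hx]
  have happrox : ∀ k : ℕ, ∃ g : BoundedContinuousFunction X ℝ,
      ∫ x, ‖A k x - g x‖ ∂μ ≤ 1 / ((k : ℝ) + 1) ∧ Integrable g μ := fun k =>
    (hAi k).exists_boundedContinuous_integral_sub_le (by positivity)
  choose g hg hgi using happrox
  -- Clipping at 0 does not increase the distance to the nonnegative truncation, and the added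
  -- constant makes the function positive.
  set b : ℕ → X → ℝ := fun k x => max (g k x) 0 + 1 / ((k : ℝ) + 1) with hb
  have hbi : ∀ k, Integrable (b k) μ := fun k => (hgi k).pos_part.add (integrable_const _)
  refine ⟨b, fun k => by fun_prop, fun k x => ?_, ?_⟩
  · have : 0 ≤ max (g k x) 0 := le_max_right _ _
    have : 0 < 1 / ((k : ℝ) + 1) := by positivity
    simp only [hb]
    linarith
  have hdiff : Tendsto (fun k => ∫ x, b k x ∂μ - ∫ x, A k x ∂μ) atTop (𝓝 0) := by
    have hbound : ∀ k, ‖∫ x, b k x ∂μ - ∫ x, A k x ∂μ‖ ≤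
        1 / ((k : ℝ) + 1) * (1 + μ.real Set.univ) := by
      intro k
      rw [← integral_sub (hbi k) (hAi k)]
      calc ‖∫ x, b k x - A k x ∂μ‖ ≤ ∫ x, ‖b k x - A k x‖ ∂μ := norm_integral_le_integral_norm _
        _ ≤ ∫ x, (‖A k x - g k x‖ + 1 / ((k : ℝ) + 1)) ∂μ := by
            refine integral_mono ((hbi k).sub (hAi k)).norm
              (((hAi k).sub (hgi k)).norm.add (integrable_const _)) fun x => ?_
            have h1 : |max (g k x) 0 - max (A k x) 0| ≤ |g k x - A k x| :=
              abs_max_sub_max_le_abs _ _ _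
            rw [max_eq_left (hA0 k x), abs_sub_comm (g k x)] at h1
            simp only [hb, Real.norm_eq_abs]
            have h2 : max (g k x) 0 + 1 / ((k : ℝ) + 1) - A k x =
                (max (g k x) 0 - A k x) + 1 / ((k : ℝ) + 1) := by ring
            rw [h2]
            refine (abs_add_le _ _).trans (add_le_add h1 (le_of_eq (abs_of_pos (by positivity))))
        _ = ∫ x, ‖A k x - g k x‖ ∂μ + 1 / ((k : ℝ) + 1) * μ.real Set.univ := by
            have hsi : Integrable (fun x => ‖A k x - g k x‖) μ := ((hAi k).sub (hgi k)).norm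
            rw [integral_add hsi (integrable_const _), integral_const, smul_eq_mul, mul_comm (μ.real _)]
        _ ≤ _ := by rw [mul_add, mul_one]; gcongr; exact hg k
    refine squeeze_zero_norm hbound ?_
    simpa using (tendsto_one_div_add_atTop_nhds_zero_nat (𝕜 := ℝ)).mul_const (1 + μ.real Set.univ)
  have hreal : ∀ k, ((∫⁻ x, ENNReal.ofReal (A k x) ∂μ : ℝ≥0∞) : EReal) =
      ((∫ x, A k x ∂μ : ℝ) : EReal) := by
    intro k
    rw [← ofReal_integral_eq_lintegral_ofReal (hAi k) (Eventually.of_forall (hA0 k)),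
      EReal.coe_ennreal_ofReal, max_eq_left (integral_nonneg (hA0 k))]
  have h1 : Tendsto (fun k => ((∫ x, A k x ∂μ : ℝ) : EReal)) atTop
      (𝓝 ((∫⁻ x, ENNReal.ofReal (a x) ∂μ : ℝ≥0∞) : EReal)) := by
    simp_rw [← hreal]
    exact (continuous_coe_ennreal_ereal.tendsto _).comp hlim
  have h2 : Tendsto (fun k => ((∫ x, b k x ∂μ - ∫ x, A k x ∂μ : ℝ) : EReal)) atTop
      (𝓝 ((0 : ℝ) : EReal)) := (continuous_coe_real_ereal.tendsto _).comp hdiff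
  -- Addition is continuous here even if the integral is infinite, because the other summand tends
  -- to the finite value 0.
  have h3 := (EReal.continuousAt_add (Or.inr (EReal.coe_ne_bot 0))
    (Or.inr (EReal.coe_ne_top 0))).tendsto.comp (h1.prodMk_nhds h2)
  simp only [EReal.coe_zero, add_zero] at h3
  refine h3.congr fun k => ?_
  simp only [Function.comp_apply]
  rw [← EReal.coe_add, add_sub_cancel]

variable {n : ℕ} {K : Set (Space n)}

open Classical in
/-- The weighted floating body if it is a body, and `C` otherwise. -/
noncomputable def weightedFloatingConvexBody (C : ConvexBody (Space n)) (f : Space n → ℝ) (t : ℝ) :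
    ConvexBody (Space n) :=
  if h : IsBody (weightedFloatingBody (C : Set (Space n)) f t) then
    ⟨weightedFloatingBody (C : Set (Space n)) f t, h.convex, h.isCompact,
      ⟨0, interior_subset h.zero_mem⟩⟩
  else C

lemma coe_weightedFloatingConvexBody {C : ConvexBody (Space n)} {f : Space n → ℝ} {t : ℝ}
    (h : IsBody (weightedFloatingBody (C : Set (Space n)) f t)) :
    (weightedFloatingConvexBody C f t : Set (Space n)) =
      weightedFloatingBody (C : Set (Space n)) f t := by
  rw [weightedFloatingConvexBody, dif_pos h]
  rfl

lemma zero_mem_interior_weightedFloatingConvexBody {C : ConvexBody (Space n)}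
    (hC : (0 : Space n) ∈ interior (C : Set (Space n))) (f : Space n → ℝ) (t : ℝ) :
    (0 : Space n) ∈ interior (weightedFloatingConvexBody C f t : Set (Space n)) := by
  by_cases h : IsBody (weightedFloatingBody (C : Set (Space n)) f t)
  · rw [coe_weightedFloatingConvexBody h]
    exact h.zero_mem
  · rwa [weightedFloatingConvexBody, dif_neg h]

section ConvexBody

variable [NeZero n] {C : ConvexBody (Space n)}

lemma tendsto_weightedFloatingConvexBody (hC : IsRegularBody (C : Set (Space n)))
    {f : Space n → ℝ} (hf : IsAngularWeight f) :
    Tendsto (fun t : ℝ => (((volume.real (polarBody (weightedFloatingConvexBody C f t :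
        Set (Space n))) - volume.real (polarBody (C : Set (Space n)))) / t : ℝ) : EReal)) (𝓝[>] 0)
      (𝓝 ((n * ∫ x in C, dualityJacobian C x * f x : ℝ) : EReal)) := by
  obtain ⟨t₀, ht₀, h⟩ := hC.exists_isBody_floatingBody hf
  refine ((continuous_coe_real_ereal.tendsto _).comp
    (hC.tendsto_volume_polar_quotient hf)).congr' ?_
  filter_upwards [Ioo_mem_nhdsGT ht₀] with t ht
  rw [Function.comp_apply, coe_weightedFloatingConvexBody (h t ht.1 ht.2)]

end ConvexBody

namespace IsRegularBody

lemma isFiniteMeasure_coneMeasure (hK : IsRegularBody K) : IsFiniteMeasure (coneMeasure K) := by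
  have : Fact (volume K < ⊤) := ⟨hK.isCompact.measure_lt_top⟩
  refine ⟨?_⟩
  rw [coneMeasure, Measure.smul_apply, smul_eq_mul]
  exact ENNReal.mul_lt_top (ENNReal.natCast_lt_top n) (measure_lt_top _ _)

lemma measurable_radial (hK : IsRegularBody K) : Measurable fun x => (gauge K x)⁻¹ • x :=
  hK.continuous_gauge.measurable.inv.smul measurable_id

lemma continuousAt_comp_radial (hK : IsRegularBody K) {b : Space n → ℝ} (hb : Continuous b)
    {x : Space n} (hx : x ≠ 0) : ContinuousAt (fun y => b ((gauge K y)⁻¹ • y)) x :=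
  hb.continuousAt.comp (hK.continuousAt_radial hx)

lemma radial_smul (hK : IsRegularBody K) (x : Space n) {t : ℝ} (ht : 0 < t) :
    (gauge K (t • x))⁻¹ • (t • x) = (gauge K x)⁻¹ • x := by
  rw [hK.gauge_smul ht.le, mul_inv, smul_smul, mul_right_comm, inv_mul_cancel₀ ht.ne', one_mul]

/-- The angular weight whose weighted Jacobian is the radial extension of `b`. -/
lemma isAngularWeight_radial_div (hK : IsRegularBody K) {b : Space n → ℝ} (hb : Continuous b)
    (hb0 : ∀ x, 0 < b x) :
    IsAngularWeight fun x => b ((gauge K x)⁻¹ • x) / dualityJacobian K x where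
  continuousAt x hx := (hK.continuousAt_comp_radial hb hx).div
    (hK.continuousAt_dualityJacobian hx) (hK.dualityJacobian_pos x hx).ne'
  smul x hx t ht := by rw [hK.radial_smul x ht, hK.dualityJacobian_smul hx ht]
  pos x hx := div_pos (hb0 _) (hK.dualityJacobian_pos x hx)

lemma centroAffineCurvature_pos (hK : IsRegularBody K) {x : Space n} (hx : x ∈ frontier K) :
    0 < centroAffineCurvature K x := by
  rw [hK.centroAffineCurvature_eq hx]
  exact hK.dualityJacobian_pos x (hK.ne_zero hx)

/-- If the cap volumes vary continuously with the direction, so does the angular weight. -/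
lemma isAngularWeight_of_continuous (hK : IsRegularBody K) {φ : ℝ → ℝ}
    (hφ : ∀ s : ℝ, 0 < s → 0 < φ s)
    (hcont : Continuous fun u : Metric.sphere (0 : Space n) 1 =>
      φ (centroAffineCurvature K (boundaryPoint K u))) :
    IsAngularWeight fun x => φ (dualityJacobian K x) / dualityJacobian K x := by
  have hpos := hK.dualityJacobian_pos
  refine ⟨fun x hx => ContinuousAt.div ?_ (hK.continuousAt_dualityJacobian hx) (hpos x hx).ne',
    fun x hx t ht => by rw [hK.dualityJacobian_smul hx ht],
    fun x hx => div_pos (hφ _ (hpos x hx)) (hpos x hx)⟩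
  have hsph : ∀ y : ({0}ᶜ : Set (Space n)),
      ‖dualityMap K y‖⁻¹ • dualityMap K y ∈ Metric.sphere (0 : Space n) 1 := fun y => by
    have := norm_pos_iff.2 (hK.dualityMap_ne_zero y.2)
    rw [mem_sphere_zero_iff_norm, norm_smul, norm_inv, norm_norm, inv_mul_cancel₀ this.ne']
  have hN : Continuous fun y : ({0}ᶜ : Set (Space n)) =>
      (⟨_, hsph y⟩ : Metric.sphere (0 : Space n) 1) := by
    refine Continuous.subtype_mk (continuous_iff_continuousAt.2 fun y => ?_) _
    have h1 : ContinuousAt (fun z : ({0}ᶜ : Set (Space n)) => dualityMap K z) y :=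
      (hK.contDiffAt_dualityMap y.2).continuousAt.comp continuousAt_subtype_val
    exact (h1.norm.inv₀ (norm_ne_zero_iff.2 (hK.dualityMap_ne_zero y.2))).smul h1
  -- Pull the function on the sphere back along y ↦ G(y)/‖G(y)‖: the boundary point with this normal
  -- is the radial projection of y, where κ₀ equals J(y).
  have h2 : Continuous fun y : ({0}ᶜ : Set (Space n)) => φ (dualityJacobian K y) := by
    refine (hcont.comp hN).congr fun y => ?_
    have hy : (y : Space n) ≠ 0 := y.2
    have hg := hK.gauge_pos hy
    have hxr := hK.radial_mem hy
    have hbp := hK.boundaryPoint_eq hxr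
    rw [hK.dualityMap_smul hy (inv_pos.2 hg), norm_smul, Real.norm_of_nonneg (inv_nonneg.2 hg.le),
      mul_inv, inv_inv, smul_smul, mul_right_comm, mul_inv_cancel₀ hg.ne', one_mul] at hbp
    simp only [Function.comp_apply, hbp]
    rw [hK.centroAffineCurvature_eq hxr, ← dualityJacobian,
      hK.dualityJacobian_smul hy (inv_pos.2 hg)]
  exact (continuousOn_iff_continuous_domRestrict.2 h2).continuousAt (isOpen_compl_singleton.mem_nhds hx)

/-- Split κ₀^(-(n+2)/(n+1)) as κ₀⁻¹ · κ₀^(-1/(n+1)): the first factor belongs to the height t φ/κ₀,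
and the second, raised to (n + 1)/2, is the κ₀^(-1/2) of the osculating ellipsoid. -/
lemma capFunction_eq (hK : IsRegularBody K) {φ : ℝ → ℝ} (hφ : ∀ s : ℝ, 0 < s → 0 < φ s)
    {x : Space n} (hx : x ∈ frontier K) {t : ℝ} (ht : 0 < t) :
    capFunction φ K t (‖dualityMap K x‖⁻¹ • dualityMap K x) =
      capTerm K x (t * (φ (dualityJacobian K x) / dualityJacobian K x)) := by
  have hJ := hK.dualityJacobian_pos x (hK.ne_zero hx)
  have hφJ := hφ _ hJ
  rw [capFunction, capTerm]
  simp only [hK.boundaryPoint_eq hx, hK.centroAffineCurvature_eq hx]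
  rw [← dualityJacobian]
  set J := dualityJacobian K x
  have hn : (0 : ℝ) < n + 1 := by positivity
  have h1 : J ^ (-(((n : ℝ) + 2) / ((n : ℝ) + 1))) = J⁻¹ * J ^ (-(1 / ((n : ℝ) + 1))) := by
    rw [← Real.rpow_neg_one J, ← Real.rpow_add hJ]
    congr 1
    field_simp
    ring
  have h2 : (J ^ (-(1 / ((n : ℝ) + 1)))) ^ (((n : ℝ) + 1) / 2) = (√J)⁻¹ := by
    rw [← Real.rpow_mul hJ.le, Real.sqrt_eq_rpow, ← Real.rpow_neg hJ.le]
    congr 1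
    field_simp
  have h3 : 2 * t * φ J * J ^ (-(((n : ℝ) + 2) / ((n : ℝ) + 1))) =
      (2 * (t * (φ J / J))) * J ^ (-(1 / ((n : ℝ) + 1))) := by
    rw [h1, div_eq_mul_inv]
    ring
  rw [h3, Real.mul_rpow (by positivity) (by positivity), h2, mul_assoc]

/-- By homogeneity the term is t^((n+1)/2) times a function that is bounded on the compact boundary.
-/
lemma exists_capTerm_lt (hK : IsRegularBody K) {f : Space n → ℝ} (hf : IsAngularWeight f)
    {v : ℝ} (hv : 0 < v) :
    ∃ t₀ > 0, ∀ t, 0 < t → t < t₀ → ∀ x ∈ frontier K, capTerm K x (t * f x) < v := by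
  have hc : ContinuousOn (fun x => capTerm K x (f x)) (frontier K) := by
    intro x hx
    have hx0 := hK.ne_zero hx
    refine ContinuousAt.continuousWithinAt ?_
    have hJ := hK.dualityJacobian_pos x hx0
    refine (continuousAt_const.mul ((continuousAt_const.mul (hf.continuousAt x hx0)).rpow_const
      (Or.inr (by positivity)))).mul
      ((hK.continuousAt_dualityJacobian hx0).sqrt.inv₀ (Real.sqrt_pos.2 hJ).ne')
  obtain ⟨M, hM⟩ := hK.isCompact_frontier.exists_bound_of_continuousOn hc
  have hlim : Tendsto (fun t : ℝ => t ^ (((n : ℝ) + 1) / 2) * M) (𝓝[>] 0) (𝓝 0) := by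
    refine Tendsto.mono_left (Continuous.tendsto' ?_ 0 _ ?_) nhdsWithin_le_nhds
    · exact (Real.continuous_rpow_const (by positivity)).mul continuous_const
    · rw [Real.zero_rpow (by positivity), zero_mul]
  obtain ⟨t₀, ht₀, h⟩ := (mem_nhdsGT_iff_exists_Ioo_subset' (zero_lt_one (α := ℝ))).1
    (hlim.eventually (gt_mem_nhds hv))
  refine ⟨t₀, ht₀, fun t ht htt x hx => ?_⟩
  have h1 : t ^ (((n : ℝ) + 1) / 2) * M < v := h ⟨ht, htt⟩
  rw [capTerm_mul ht.le (hf.pos x (hK.ne_zero hx)).le]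
  refine lt_of_le_of_lt (mul_le_mul_of_nonneg_left ?_ (Real.rpow_nonneg ht.le _)) h1
  exact (le_abs_self _).trans (hM x hx)

variable [NeZero n]

lemma ae_mem_frontier (hK : IsRegularBody K) : ∀ᵐ x ∂coneMeasure K, x ∈ frontier K := by
  rw [coneMeasure]
  refine Measure.ae_smul_measure ?_ _
  refine (ae_map_iff (p := fun x => x ∈ frontier K) hK.measurable_radial.aemeasurable
    isClosed_frontier.measurableSet).2 (ae_restrict_of_ae ?_)
  filter_upwards [Measure.ae_ne volume (0 : Space n)] with x hx using hK.radial_mem hx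

lemma integral_coneMeasure (hK : IsRegularBody K) {b : Space n → ℝ} (hb : Continuous b) :
    ∫ x, b x ∂coneMeasure K = n * ∫ x in K, dualityJacobian K x *
      (b ((gauge K x)⁻¹ • x) / dualityJacobian K x) := by
  rw [coneMeasure, integral_smul_measure, integral_map hK.measurable_radial.aemeasurable
    hb.aestronglyMeasurable, smul_eq_mul, ENNReal.toReal_natCast]
  congr 1
  refine integral_congr_ae (ae_restrict_of_ae ?_)
  filter_upwards [Measure.ae_ne volume (0 : Space n)] with x hx
  rw [mul_div_cancel₀ _ (hK.dualityJacobian_pos x hx).ne']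

lemma affineSurfaceArea_eq_ofReal (hK : IsRegularBody K) {φ : ℝ → ℝ}
    (hmeas : AEMeasurable (fun x => φ (centroAffineCurvature K x)) (coneMeasure K))
    (hf : IsAngularWeight fun x => φ (dualityJacobian K x) / dualityJacobian K x) :
    affineSurfaceArea φ K = ENNReal.ofReal (n * ∫ x in K, dualityJacobian K x *
      (φ (dualityJacobian K x) / dualityJacobian K x)) := by
  rw [hK.affineSurfaceArea_eq hmeas, ENNReal.ofReal_mul n.cast_nonneg, ENNReal.ofReal_natCast]
  have h := hK.setLIntegral_affine hf le_rfl zero_le_one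
  simp only [zero_mul, zero_add, one_mul] at h
  rw [← h]
  congr 1
  refine lintegral_congr_ae (ae_restrict_of_ae ?_)
  filter_upwards [Measure.ae_ne volume (0 : Space n)] with x hx
  rw [mul_div_cancel₀ _ (hK.dualityJacobian_pos x hx).ne']

end IsRegularBody
end PolarFloating

theorem theorem5p3 (n : ℕ) (hn : 2 ≤ n) (φ : ℝ → ℝ) (hφ : ∀ s : ℝ, 0 < s → 0 < φ s)
    (K : ConvexBody (EuclideanSpace ℝ (Fin n)))
    (hK : PolarFloating.IsC2Plus (K : Set (EuclideanSpace ℝ (Fin n))))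
    (hK0 : (0 : EuclideanSpace ℝ (Fin n)) ∈ interior (K : Set (EuclideanSpace ℝ (Fin n))))
    (hmeas : AEMeasurable
      (fun x => φ (PolarFloating.centroAffineCurvature (K : Set (EuclideanSpace ℝ (Fin n))) x))
      (PolarFloating.coneMeasure (K : Set (EuclideanSpace ℝ (Fin n))))) :
    ∃ Kφ : ℝ → ConvexBody (EuclideanSpace ℝ (Fin n)),
      -- each member of the family is a convex body with the origin in its interior
      (∀ t : ℝ, 0 < t →
        (0 : EuclideanSpace ℝ (Fin n)) ∈ interior (Kφ t : Set (EuclideanSpace ℝ (Fin n)))) ∧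
      -- the limit formula (the value is allowed to be infinite)
      Tendsto
        (fun t : ℝ =>
          (((volume.real (PolarFloating.polarBody (Kφ t : Set (EuclideanSpace ℝ (Fin n)))) -
              volume.real (PolarFloating.polarBody (K : Set (EuclideanSpace ℝ (Fin n))))) / t : ℝ) :
            EReal))
        (𝓝[>] 0)
        (𝓝 ((PolarFloating.affineSurfaceArea φ (K : Set (EuclideanSpace ℝ (Fin n))) : ℝ≥0∞) :
          EReal)) ∧
      -- if the cap volumes vary continuously with the direction, the value is finite and the family
      -- consists of the floating bodies with these cap volumes
      (Continuous (fun u : Metric.sphere (0 : EuclideanSpace ℝ (Fin n)) 1 =>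
          φ (PolarFloating.centroAffineCurvature (K : Set (EuclideanSpace ℝ (Fin n)))
            (PolarFloating.boundaryPoint (K : Set (EuclideanSpace ℝ (Fin n))) u))) →
        PolarFloating.affineSurfaceArea φ (K : Set (EuclideanSpace ℝ (Fin n))) ≠ ∞ ∧
        ∃ t₀ : ℝ, 0 < t₀ ∧ ∀ t : ℝ, 0 < t → t < t₀ →
          (∀ u : EuclideanSpace ℝ (Fin n), ‖u‖ = 1 →
            PolarFloating.capFunction φ (K : Set (EuclideanSpace ℝ (Fin n))) t u <
              volume.real (K : Set (EuclideanSpace ℝ (Fin n))) / 2) ∧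
          (Kφ t : Set (EuclideanSpace ℝ (Fin n))) =
            PolarFloating.floatingBody (K : Set (EuclideanSpace ℝ (Fin n)))
              (PolarFloating.capFunction φ (K : Set (EuclideanSpace ℝ (Fin n))) t)) := by
  have : NeZero n := ⟨by omega⟩
  have hreg : PolarFloating.IsRegularBody (K : Set (EuclideanSpace ℝ (Fin n))) :=
    (PolarFloating.IsBody.isSmoothBody ⟨K.convex, K.isCompact, hK0⟩ hK.1).isRegularBody hK.2
  have hfin := hreg.isFiniteMeasure_coneMeasure
  by_cases hcont : Continuous (fun u : Metric.sphere (0 : EuclideanSpace ℝ (Fin n)) 1 =>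
      φ (PolarFloating.centroAffineCurvature (K : Set (EuclideanSpace ℝ (Fin n)))
        (PolarFloating.boundaryPoint (K : Set (EuclideanSpace ℝ (Fin n))) u)))
  · have hf := hreg.isAngularWeight_of_continuous hφ hcont
    have harea := hreg.affineSurfaceArea_eq_ofReal hmeas hf
    refine ⟨PolarFloating.weightedFloatingConvexBody K fun x =>
      φ (PolarFloating.dualityJacobian (K : Set (EuclideanSpace ℝ (Fin n))) x) /
        PolarFloating.dualityJacobian (K : Set (EuclideanSpace ℝ (Fin n))) x, fun t _ =>
      PolarFloating.zero_mem_interior_weightedFloatingConvexBody hK0 _ t, ?_, fun _ => ⟨?_, ?_⟩⟩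
    · have h := PolarFloating.tendsto_weightedFloatingConvexBody hreg hf
      rw [harea, EReal.coe_ennreal_ofReal, max_eq_left]
      · exact h
      · refine mul_nonneg n.cast_nonneg (integral_nonneg_of_ae (ae_restrict_of_ae ?_))
        filter_upwards [Measure.ae_ne volume (0 : EuclideanSpace ℝ (Fin n))] with x hx
        exact (mul_pos (hreg.dualityJacobian_pos x hx) (hf.pos x hx)).le
    · rw [harea]
      exact ENNReal.ofReal_ne_top
    · have hvol : 0 < volume.real (K : Set (EuclideanSpace ℝ (Fin n))) :=
        ENNReal.toReal_pos (Measure.measure_pos_of_mem_nhds volume hreg.mem_nhds).ne'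
          K.isCompact.measure_lt_top.ne
      obtain ⟨t₁, ht₁, h₁⟩ := hreg.exists_isBody_floatingBody hf
      obtain ⟨t₂, ht₂, h₂⟩ := hreg.exists_capTerm_lt hf (half_pos hvol)
      refine ⟨min t₁ t₂, lt_min ht₁ ht₂, fun t ht htt => ⟨fun u hu => ?_, ?_⟩⟩
      · obtain ⟨x, hx, rfl⟩ := hreg.exists_unit_eq hu
        rw [hreg.capFunction_eq hφ hx ht]
        exact h₂ t ht (htt.trans_le (min_le_right _ _)) x hx
      · rw [PolarFloating.coe_weightedFloatingConvexBody
          (h₁ t ht (htt.trans_le (min_le_left _ _)))]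
        -- Every unit vector is the normal at some boundary point, where the two prescribed cap
        -- volumes coincide.
        ext y
        refine forall₂_congr fun u hu => forall_congr' fun s => ?_
        obtain ⟨x, hx, rfl⟩ := hreg.exists_unit_eq hu
        beta_reduce
        rw [hreg.capFunction_eq hφ hx ht, hreg.boundaryPoint_eq hx]
  -- Without continuity only the limit formula is claimed, so each t may use its own approximating
  -- weight.
  · have ha0 : ∀ᵐ x ∂PolarFloating.coneMeasure (K : Set (EuclideanSpace ℝ (Fin n))),
        0 ≤ φ (PolarFloating.centroAffineCurvature (K : Set (EuclideanSpace ℝ (Fin n))) x) := by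
      filter_upwards [hreg.ae_mem_frontier] with x hx
      exact (hφ _ (hreg.centroAffineCurvature_pos hx)).le
    obtain ⟨b, hb, hb0, hlim⟩ := PolarFloating.exists_continuous_tendsto_integral _ hmeas ha0
    simp_rw [fun k => hreg.integral_coneMeasure (hb k)] at hlim
    have hf := fun k => hreg.isAngularWeight_radial_div (hb k) (hb0 k)
    obtain ⟨k, hk⟩ := PolarFloating.exists_diagonal
      (fun k => PolarFloating.tendsto_weightedFloatingConvexBody hreg (hf k)) hlim
    exact ⟨fun t => PolarFloating.weightedFloatingConvexBody K
      (fun x => b (k t) ((gauge (K : Set (EuclideanSpace ℝ (Fin n))) x)⁻¹ • x) /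
        PolarFloating.dualityJacobian (K : Set (EuclideanSpace ℝ (Fin n))) x) t, fun t _ =>
      PolarFloating.zero_mem_interior_weightedFloatingConvexBody hK0 _ t, hk,
      fun h => absurd h hcont⟩
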